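/- For $\rho\in\{-1,1,*\}^n$ let $Q_\rho$ be the subcube of all $x\in\{-1,1\}^n$ with $x_i=\rho_i$ whenever $\rho_i\ne *$. A subcube conditioning query $\rho$ to a probability distribution $p$ on $\{-1,1\}^n$ returns a sample of $p$ conditioned on $Q_\rho$ (a uniformly random point of $Q_\rho$ if $p(Q_\rho)=0$). The distribution $p$ is a $k$-junta distribution if its probability mass function depends on at most $k$ of the $n$ variables, and $p$ is $\varepsilon$-far from every $k$-junta distribution if $d_{\mathrm{TV}}(p,q)\ge\varepsilon$ for every $k$-junta distribution $q$ on $\{-1,1\}^n$. Theorem (Lower bound for junta testing). There exist absolute constants $\varepsilon_0>0$, $C_0\in\mathbb N$, $c>0$ and $d\in\mathbb N$ such that the following holds for all $0<\varepsilon\le\varepsilon_0$ and all integers $n\ge C_0$ and $0\le k\le n/2$. Let $A$ be a randomized adaptive algorithm which makes at most $q$ subcube conditioning queries to an unknown distribution $p$ on $\{-1,1\}^n$, accepts with probability at least $2/3$ if $p$ is a $k$-junta distribution, and rejects with probability at least $2/3$ if $p$ is $\varepsilon$-far from every $k$-junta distribution. Then $$q\;\ge\;\frac{c}{\varepsilon^2}\cdot\frac{k+\sqrt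 n}{1+|\log(k+\sqrt n)|^{d}},$$ that is, $A$ needs $\tilde\Omega(k+\sqrt n)/\varepsilon^2$ queries. Furthermore, the same lower bound holds if $A$ is only required to satisfy these guarantees for product distributions $p$. -/

import Mathlib

namespace JuntaTesting

/-- The cube of dimension `n`. Each of the two signs `-1`, `1` is encoded by a Boolean. -/
abbrev Cube (n : ℕ) : Type := Fin n → Bool

/-- A restriction, that is, a string over the two signs and a star; `none` is the star. -/
abbrev Restriction (n : ℕ) : Type := Fin n → Option Bool

/-- The subcube of all points that agree with every non-star entry of `ρ`. -/
def subcube {n : ℕ} (ρ : Restriction n) : Finset (Cube n) :=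
  Finset.univ.filter fun x => ∀ i, ρ i = none ∨ ρ i = some (x i)

theorem subcube_nonempty {n : ℕ} (ρ : Restriction n) : (subcube ρ).Nonempty := by
  refine ⟨fun i => (ρ i).getD false, ?_⟩
  simp only [subcube, Finset.mem_filter, Finset.mem_univ, true_and]
  intro i
  cases h : ρ i <;> simp

open Classical in
/-- The distribution of the oracle's answer to the query `ρ`: a sample of `p` conditioned on lying
in the subcube of `ρ`, and a uniform point of the subcube if `p` gives it probability zero. -/
noncomputable def oracle {n : ℕ} (p : PMF (Cube n)) (ρ : Restriction n) : PMF (Cube n) :=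
  if h : ∃ x ∈ (subcube ρ : Set (Cube n)), x ∈ p.support then
    p.filter (subcube ρ : Set (Cube n)) h
  else PMF.uniformOfFinset (subcube ρ) (subcube_nonempty ρ)

/-- A deterministic adaptive algorithm with access to the oracle: it either stops with a verdict
(`true` is accept, `false` is reject), or it makes a query and goes on depending on the answer. -/
inductive DetAlg (n : ℕ) : Type
  | output (verdict : Bool) : DetAlg n
  | query (ρ : Restriction n) (next : Cube n → DetAlg n) : DetAlg n

/-- The largest number of queries made on any run; only answers in the queried subcube count. -/
def DetAlg.queries {n : ℕ} : DetAlg n → ℕ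
  | .output _ => 0
  | .query ρ next => 1 + (subcube ρ).sup fun x => (next x).queries

/-- The distribution of the verdict when the unknown distribution is `p`. -/
noncomputable def DetAlg.run {n : ℕ} (p : PMF (Cube n)) : DetAlg n → PMF Bool
  | .output b => PMF.pure b
  | .query ρ next => (oracle p ρ).bind fun x => (next x).run p

/-- A randomized algorithm is a probability distribution over deterministic ones (of which there
are countably many, since there are finitely many queries and answers). -/
abbrev RandAlg (n : ℕ) : Type := PMF (DetAlg n)

/-- The distribution of the verdict, over the coins of the algorithm and the oracle's answers. -/
noncomputable def RandAlg.run {n : ℕ} (A : RandAlg n) (p : PMF (Cube n)) : PMF Bool :=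
  A.bind fun T => T.run p

/-- The algorithm never makes more than `q` queries. -/
def RandAlg.MakesAtMost {n : ℕ} (A : RandAlg n) (q : ℕ) : Prop :=
  ∀ T ∈ A.support, T.queries ≤ q

/-- `p` is a `k`-junta distribution: its probability mass function depends on at most `k`
variables. -/
def IsJunta {n : ℕ} (k : ℕ) (p : PMF (Cube n)) : Prop :=
  ∃ J : Finset (Fin n), J.card ≤ k ∧ DependsOn (fun x : Cube n => p x) (J : Set (Fin n))

/-- Total variation distance. -/
noncomputable def dTV {n : ℕ} (p q : PMF (Cube n)) : ℝ :=
  (∑ x, |(p x).toReal - (q x).toReal|) / 2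

/-- `p` is `ε`-far from every `k`-junta distribution. -/
def IsFarFromJunta {n : ℕ} (k : ℕ) (ε : ℝ) (p : PMF (Cube n)) : Prop :=
  ∀ q : PMF (Cube n), IsJunta k q → ε ≤ dTV p q

/-- `p` is a product distribution: its coordinates are independent. -/
def IsProduct {n : ℕ} (p : PMF (Cube n)) : Prop :=
  ∃ f : Fin n → PMF Bool, ∀ x, p x = ∏ i, f i (x i)

/-- `A` distinguishes, with probability at least `2/3`, the `k`-junta distributions from those
that are `ε`-far from every `k`-junta distribution, for unknown distributions promised to lie in
the class `P`. -/
def IsJuntaTester {n : ℕ} (P : Set (PMF (Cube n))) (k : ℕ) (ε : ℝ) (A : RandAlg n) : Prop :=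
  ∀ p ∈ P, (IsJunta k p → 2 / 3 ≤ A.run p true) ∧ (IsFarFromJunta k ε p → 2 / 3 ≤ A.run p false)

end JuntaTesting

namespace JuntaTesting
variable {n : ℕ}

/-! It suffices to defeat testers for product distributions. When a product distribution has full
support, conditioning on a subcube just overwrites the fixed coordinates of an ordinary sample, so
`q` adaptive queries are no better than `q` independent samples (`exists_test_of_detAlg`).

For samples the argument is Le Cam's two-prior method. The means of the coordinates in a set `B` are
drawn independently as `δ` times a random integer in `[-L, L]`, binomially distributed and
conditioned to be even (yes) or odd (no). The difference of the two priors is an alternating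
binomial sum, that is, a finite difference of order `2L`, so their moments below `2L` agree.

An even integer is zero with probability at least `1/L`, so the yes-distribution has at most `k`
nonzero means with high probability and is then a `k`-junta. An odd integer is never zero, so
outside any `k` coordinates the squared means sum to at least `(|B| - k) δ²`, which forces distance
`ε` from juntas (`isFarFromJunta_meanPMF`).

Matching moments make the chi-squared divergence per coordinate at most `8 L (q L² δ²)^(2L)`
(`MatchedPriors.sum_sq_le`), and chi-squared tensorises over coordinates
(`sum_prod_sub_le_of_chiSq`). Taking `L = 1` on all coordinates gives `√n / ε²`; taking `L` about
`log₂ k` and `|B| - k` about `k / (4L)` gives `k / (ε² L³)`. -/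

/-! ### Reduction from subcube queries to independent samples. -/

/-- Replace the coordinates of `y` that are fixed by `ρ` with their values under `ρ`. -/
def overwrite (ρ : Restriction n) (y : Cube n) : Cube n := fun i => (ρ i).getD (y i)

theorem overwrite_mem_subcube (ρ : Restriction n) (y : Cube n) : overwrite ρ y ∈ subcube ρ := by
  simp only [subcube, Finset.mem_filter, Finset.mem_univ, true_and, overwrite]
  intro i
  cases h : ρ i <;> simp

theorem sum_prod_eq_prod_sum {ι κ R : Type*} [Fintype ι] [DecidableEq ι] [Fintype κ]
    [CommSemiring R] (g : ι → κ → R) : ∑ x : ι → κ, ∏ i, g i (x i) = ∏ i, ∑ b, g i b := by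
  rw [Finset.prod_univ_sum, Fintype.piFinset_univ]

/-- The product distribution with given marginals. -/
noncomputable def productPMF (f : Fin n → PMF Bool) : PMF (Cube n) :=
  PMF.ofFintype (fun x => ∏ i, f i (x i)) (by
    rw [sum_prod_eq_prod_sum]
    refine Finset.prod_eq_one fun i _ => ?_
    rw [← tsum_fintype (L := SummationFilter.unconditional _)]
    exact (f i).tsum_coe)

theorem productPMF_apply (f : Fin n → PMF Bool) (x : Cube n) :
    productPMF f x = ∏ i, f i (x i) := rfl

theorem isProduct_productPMF (f : Fin n → PMF Bool) : IsProduct (productPMF f) :=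
  ⟨f, fun _ => rfl⟩

/-- For a product distribution of full support, conditioning on a subcube amounts to overwriting
the fixed coordinates of an unconditional sample. -/
theorem oracle_productPMF (f : Fin n → PMF Bool) (hf : ∀ i b, f i b ≠ 0) (ρ : Restriction n) :
    oracle (productPMF f) ρ = (productPMF f).map (overwrite ρ) := by
  classical
  have hsum : ∀ i, f i true + f i false = 1 := fun i => by
    have := (f i).tsum_coe
    rwa [tsum_fintype, Fintype.sum_bool] at this
  have hex : ∃ x ∈ (subcube ρ : Set (Cube n)), x ∈ (productPMF f).support := by
    obtain ⟨x, hx⟩ := subcube_nonempty ρ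
    refine ⟨x, hx, ?_⟩
    rw [PMF.mem_support_iff, productPMF_apply]
    exact Finset.prod_ne_zero_iff.2 fun i _ => hf i _
  rw [oracle, dif_pos hex]
  ext x
  have hind : ∀ y, (subcube ρ : Set (Cube n)).indicator (productPMF f) y
      = ∏ i, (if ρ i = none ∨ ρ i = some (y i) then f i (y i) else 0) := by
    intro y
    by_cases hy : y ∈ subcube ρ
    · rw [Set.indicator_of_mem (by exact_mod_cast hy), productPMF_apply]
      simp only [subcube, Finset.mem_filter, Finset.mem_univ, true_and] at hy
      exact Finset.prod_congr rfl fun i _ => by rw [if_pos (hy i)]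
    · rw [Set.indicator_of_notMem (by exact_mod_cast hy)]
      simp only [subcube, Finset.mem_filter, Finset.mem_univ, true_and, not_forall] at hy
      obtain ⟨i, hi⟩ := hy
      exact (Finset.prod_eq_zero (Finset.mem_univ i) (if_neg hi)).symm
  rw [PMF.filter_apply, PMF.map_apply, tsum_fintype, tsum_fintype]
  simp_rw [hind]
  rw [sum_prod_eq_prod_sum (fun i b => if ρ i = none ∨ ρ i = some b then f i b else 0)]
  have hmap : ∀ y, (if x = overwrite ρ y then productPMF f y else 0)
      = ∏ i, (if x i = (ρ i).getD (y i) then f i (y i) else 0) := by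
    intro y
    by_cases hy : x = overwrite ρ y
    · rw [if_pos hy, productPMF_apply]
      exact Finset.prod_congr rfl fun i _ => (if_pos (congrFun hy i)).symm
    · rw [if_neg hy]
      obtain ⟨i, hi⟩ := Function.ne_iff.1 hy
      exact (Finset.prod_eq_zero (Finset.mem_univ i) (if_neg hi)).symm
  have hm : (∑ a, @ite _ (x = overwrite ρ a) (Classical.propDecidable _) (productPMF f a) 0)
      = ∏ i, ∑ b, (if x i = (ρ i).getD b then f i b else 0) := by
    rw [← sum_prod_eq_prod_sum]
    refine Finset.sum_congr rfl fun y _ => ?_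
    rw [← hmap y]
    congr
  rw [hm, ← div_eq_mul_inv]
  -- The normalising constant factors over coordinates, with factor 1 at a star and `f i b` at a
  -- fixed `b`. These are nonzero and finite, so the identity can be checked factor by factor.
  have hc : ∀ i, (∑ b, if ρ i = none ∨ ρ i = some b then f i b else 0) ≠ 0 ∧
      (∑ b, if ρ i = none ∨ ρ i = some b then f i b else 0) ≠ ⊤ := by
    intro i
    rw [Fintype.sum_bool]
    rcases h : ρ i with _ | b
    · simp [hsum]
    · cases b <;> simp [hf, PMF.apply_ne_top]
  symm
  rw [ENNReal.eq_div_iff (Finset.prod_ne_zero_iff.2 fun i _ => (hc i).1)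
    (ENNReal.prod_ne_top fun i _ => (hc i).2), ← Finset.prod_mul_distrib]
  refine Finset.prod_congr rfl fun i _ => ?_
  simp only [Fintype.sum_bool]
  rcases h : ρ i with _ | b
  · cases hx : x i <;> simp [hsum]
  · cases b <;> cases hx : x i <;> simp [hsum]

/-- Against product distributions of full support, an adaptive algorithm with `q` queries is no
more powerful than a test that sees `q` independent samples. -/
theorem exists_test_of_detAlg (q : ℕ) : ∀ T : DetAlg n, T.queries ≤ q →
    ∃ G : (Fin q → Cube n) → Bool, ∀ f : Fin n → PMF Bool, (∀ i b, f i b ≠ 0) → ∀ b,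
      T.run (productPMF f) b
        = ∑ y : Fin q → Cube n, (∏ t, productPMF f (y t)) * (if G y = b then 1 else 0) := by
  have hone : ∀ p : PMF (Cube n), ∑ x, p x = 1 := fun p => by
    rw [← tsum_fintype (L := SummationFilter.unconditional _)]
    exact p.tsum_coe
  have hout : ∀ (q : ℕ) (v : Bool), ∃ G : (Fin q → Cube n) → Bool, ∀ f : Fin n → PMF Bool,
      (∀ i b, f i b ≠ 0) → ∀ b, (DetAlg.output v : DetAlg n).run (productPMF f) b
        = ∑ y : Fin q → Cube n, (∏ t, productPMF f (y t)) * (if G y = b then 1 else 0) := by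
    intro q v
    refine ⟨fun _ => v, fun f _ b => ?_⟩
    rw [← Finset.sum_mul, sum_prod_eq_prod_sum (fun _ x => productPMF f x)]
    simp [hone, DetAlg.run, PMF.pure_apply, eq_comm]
  induction q with
  | zero =>
    intro T hT
    cases T with
    | output v => exact hout 0 v
    | query ρ next => simp [DetAlg.queries] at hT
  | succ q ih =>
    intro T hT
    cases T with
    | output v => exact hout (q + 1) v
    | query ρ next =>
      have hnext : ∀ x : Cube n, (next (overwrite ρ x)).queries ≤ q := by
        intro x
        have h1 := Finset.le_sup (f := fun x => (next x).queries) (overwrite_mem_subcube ρ x)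
        simp only [DetAlg.queries] at hT
        omega
      choose G hG using fun x : Cube n => ih (next (overwrite ρ x)) (hnext x)
      -- Each query consumes a fresh sample, so adaptivity costs nothing; samples left over after an
      -- early stop are ignored.
      refine ⟨fun y => G (y 0) (Fin.tail y), fun f hf b => ?_⟩
      rw [DetAlg.run, oracle_productPMF f hf, PMF.bind_map, PMF.bind_apply, tsum_fintype]
      rw [← (Fin.consEquiv fun _ : Fin (q + 1) => Cube n).sum_comp, Fintype.sum_prod_type]
      refine Finset.sum_congr rfl fun x _ => ?_
      rw [Function.comp_apply, hG x f hf b, Finset.mul_sum]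
      refine Finset.sum_congr rfl fun y _ => ?_
      simp [Fin.consEquiv, Fin.prod_univ_succ]

/-! ### Product distributions with prescribed means. -/

/-- The sign encoded by a Boolean, as a real number. -/
def sgn (b : Bool) : ℝ := if b then 1 else -1

@[simp] theorem sgn_true : sgn true = 1 := rfl

@[simp] theorem sgn_false : sgn false = -1 := rfl

theorem one_add_mul_sgn_pos {μ : ℝ} (h : |μ| < 1) (b : Bool) : 0 < 1 + μ * sgn b := by
  rw [abs_lt] at h
  cases b <;> simp <;> linarith [h.1, h.2]

/-- The distribution on the two signs with mean `μ`. -/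
noncomputable def signPMF (μ : ℝ) (h : |μ| < 1) : PMF Bool :=
  PMF.ofFintype (fun b => ENNReal.ofReal ((1 + μ * sgn b) / 2)) (by
    rw [Fintype.sum_bool, ← ENNReal.ofReal_add
      (div_nonneg (one_add_mul_sgn_pos h _).le zero_le_two)
      (div_nonneg (one_add_mul_sgn_pos h _).le zero_le_two), ENNReal.ofReal_eq_one]
    simp only [sgn_true, sgn_false]
    ring)

theorem signPMF_apply {μ : ℝ} (h : |μ| < 1) (b : Bool) :
    signPMF μ h b = ENNReal.ofReal ((1 + μ * sgn b) / 2) := rfl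

theorem signPMF_ne_zero {μ : ℝ} (h : |μ| < 1) (b : Bool) : signPMF μ h b ≠ 0 := by
  rw [signPMF_apply, ne_eq, ENNReal.ofReal_eq_zero, not_le]
  exact half_pos (one_add_mul_sgn_pos h b)

/-- The product distribution on the cube with given means. -/
noncomputable def meanPMF (μ : Fin n → ℝ) (h : ∀ i, |μ i| < 1) : PMF (Cube n) :=
  productPMF fun i => signPMF (μ i) (h i)

theorem meanPMF_toReal (μ : Fin n → ℝ) (h : ∀ i, |μ i| < 1) (x : Cube n) :
    (meanPMF μ h x).toReal = ∏ i, (1 + μ i * sgn (x i)) / 2 := by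
  rw [meanPMF, productPMF_apply, ENNReal.toReal_prod]
  refine Finset.prod_congr rfl fun i _ => ?_
  rw [signPMF_apply, ENNReal.toReal_ofReal (half_pos (one_add_mul_sgn_pos (h i) _)).le]

theorem isJunta_meanPMF {k : ℕ} (μ : Fin n → ℝ) (h : ∀ i, |μ i| < 1)
    (hk : (Finset.univ.filter fun i => μ i ≠ 0).card ≤ k) : IsJunta k (meanPMF μ h) := by
  refine ⟨_, hk, fun x y hxy => ?_⟩
  simp only [meanPMF, productPMF_apply]
  refine Finset.prod_congr rfl fun i _ => ?_
  by_cases hi : μ i = 0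
  · simp [signPMF_apply, hi]
  · rw [hxy i (by simpa using hi)]

/-! ### Distance from juntas. -/

/-- Functions of disjoint sets of coordinates are independent under the uniform distribution. -/
theorem sum_mul_of_dependsOn {f g : Cube n → ℝ} {T : Finset (Fin n)}
    (hf : DependsOn f (T : Set (Fin n))) (hg : DependsOn g ((T : Set (Fin n))ᶜ)) :
    2 ^ n * ∑ x, f x * g x = (∑ x, f x) * ∑ x, g x := by
  let mix : Cube n → Cube n → Cube n := fun x y i => if i ∈ T then x i else y i
  -- Exchanging the coordinates outside `T` between two independent uniform points preserves their
  -- joint law.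
  have hinv : Function.Involutive fun z : Cube n × Cube n => (mix z.1 z.2, mix z.2 z.1) := by
    rintro ⟨x, y⟩
    refine Prod.ext (funext fun i => ?_) (funext fun i => ?_) <;>
      by_cases hi : i ∈ T <;> simp [mix, hi]
  have hfm : ∀ x y, f (mix x y) = f x := fun x y => hf fun i hi => by
    simp [mix, Finset.mem_coe.1 hi]
  have hgm : ∀ x y, g (mix x y) = g y := fun x y => hg fun i hi => by
    have : i ∉ T := hi
    simp [mix, this]
  calc 2 ^ n * ∑ x, f x * g x = ∑ z : Cube n × Cube n, f z.1 * g z.1 := by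
        rw [Fintype.sum_prod_type]
        simp [Finset.mul_sum]
    _ = ∑ z : Cube n × Cube n, f z.1 * g z.2 := by
        rw [← Equiv.sum_comp hinv.toPerm]
        exact Finset.sum_congr rfl fun z _ => by
          simp [Function.Involutive.toPerm, hfm, hgm]
    _ = _ := by rw [Fintype.sum_prod_type, Finset.sum_mul_sum]

theorem sum_prod_subset (T : Finset (Fin n)) (g : Fin n → Bool → ℝ) :
    ∑ x : Cube n, ∏ i ∈ T, g i (x i) = 2 ^ n * ∏ i ∈ T, (g i true + g i false) / 2 := by
  have h1 : ∀ x : Cube n, ∏ i ∈ T, g i (x i) = ∏ i, (if i ∈ T then g i (x i) else 1) := fun x => by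
    rw [Finset.prod_ite_mem_eq]
  simp_rw [h1]
  rw [sum_prod_eq_prod_sum (fun i b => if i ∈ T then g i b else 1),
    ← Finset.prod_ite_mem_eq T (fun i => (g i true + g i false) / 2)]
  have h2 : (2 : ℝ) ^ n = ∏ _i : Fin n, (2 : ℝ) := by simp
  rw [h2, ← Finset.prod_mul_distrib]
  refine Finset.prod_congr rfl fun i _ => ?_
  rw [Fintype.sum_bool]
  split_ifs <;> ring

theorem one_add_sum_le_prod {ι : Type*} (T : Finset ι) {f : ι → ℝ} (hf : ∀ i, 0 ≤ f i) :
    1 + ∑ i ∈ T, f i ≤ ∏ i ∈ T, (1 + f i) := by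
  classical
  induction T using Finset.induction_on with
  | empty => simp
  | insert a s ha ih =>
    rw [Finset.sum_insert ha, Finset.prod_insert ha]
    have h0 : 0 ≤ ∑ i ∈ s, f i := Finset.sum_nonneg fun i _ => hf i
    nlinarith [hf a, mul_nonneg (hf a) h0]

/-- Averaged over `v`, this bounds the first absolute moment below by the second and fourth moments;
the scale `t` is free to be optimised. -/
theorem abs_ge_sq_sub_pow_four {v t : ℝ} (ht : 0 < t) : v ^ 2 / t - v ^ 4 / t ^ 3 ≤ |v| := by
  have key : ∀ u : ℝ, 0 ≤ u → u ^ 2 - u ^ 4 ≤ u := by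
    intro u hu
    have h1 : 0 ≤ 1 - u + u ^ 3 := by
      rcases le_total u 1 with h | h
      · nlinarith [pow_nonneg hu 3]
      · nlinarith [mul_nonneg hu (sub_nonneg.2 h), mul_nonneg (mul_nonneg hu (sub_nonneg.2 h)) hu]
    nlinarith [mul_nonneg hu h1]
  have h := mul_le_mul_of_nonneg_right (key (|v| / t) (by positivity)) ht.le
  have e1 : ((|v| / t) ^ 2 - (|v| / t) ^ 4) * t = v ^ 2 / t - v ^ 4 / t ^ 3 := by
    rw [div_pow, div_pow, sq_abs, show |v| ^ 4 = v ^ 4 from Even.pow_abs ⟨2, rfl⟩ v]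
    field_simp
  rwa [e1, div_mul_cancel₀ _ ht.ne'] at h

/-- The `L¹` distance to uniform of a product distribution is at least of the order of the
Euclidean norm of its means, provided that the latter is small. -/
theorem sum_abs_prod_sub_one_ge (T : Finset (Fin n)) (μ : Fin n → ℝ)
    (hpos : 0 < ∑ i ∈ T, μ i ^ 2) (hle : ∑ i ∈ T, μ i ^ 2 ≤ 1 / 12) :
    2 ^ n * (√(∑ i ∈ T, μ i ^ 2) / 20)
      ≤ ∑ x : Cube n, |∏ i ∈ T, (1 + μ i * sgn (x i)) - 1| := by
  set A := ∑ i ∈ T, μ i ^ 2 with hA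
  set t := √A with ht
  have ht0 : 0 < t := Real.sqrt_pos.2 hpos
  have htA : t ^ 2 = A := Real.sq_sqrt hpos.le
  have hM : ∀ m : ℕ, ∑ x : Cube n, (∏ i ∈ T, (1 + μ i * sgn (x i))) ^ m
      = 2 ^ n * ∏ i ∈ T, ((1 + μ i) ^ m + (1 - μ i) ^ m) / 2 := by
    intro m
    simp_rw [← Finset.prod_pow]
    rw [sum_prod_subset T fun i b => (1 + μ i * sgn b) ^ m]
    simp [sub_eq_add_neg]
  have h1 : ∏ i ∈ T, ((1 + μ i) ^ 1 + (1 - μ i) ^ 1) / 2 = 1 :=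
    Finset.prod_eq_one fun i _ => by ring
  have h2 : ∏ i ∈ T, ((1 + μ i) ^ 2 + (1 - μ i) ^ 2) / 2 = ∏ i ∈ T, (1 + μ i ^ 2) :=
    Finset.prod_congr rfl fun i _ => by ring
  have h3 : ∏ i ∈ T, ((1 + μ i) ^ 3 + (1 - μ i) ^ 3) / 2 = ∏ i ∈ T, (1 + 3 * μ i ^ 2) :=
    Finset.prod_congr rfl fun i _ => by ring
  have h4 : ∏ i ∈ T, ((1 + μ i) ^ 4 + (1 - μ i) ^ 4) / 2
      = ∏ i ∈ T, (1 + (6 * μ i ^ 2 + μ i ^ 4)) :=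
    Finset.prod_congr rfl fun i _ => by ring
  set M2 := ∏ i ∈ T, (1 + μ i ^ 2)
  set M3 := ∏ i ∈ T, (1 + 3 * μ i ^ 2)
  set M4 := ∏ i ∈ T, (1 + (6 * μ i ^ 2 + μ i ^ 4))
  have b2 : 1 + A ≤ M2 := one_add_sum_le_prod T fun i => sq_nonneg _
  have b3 : 1 + 3 * A ≤ M3 := by
    rw [hA, Finset.mul_sum]
    exact one_add_sum_le_prod T fun i => by positivity
  have hexp : ∀ x : ℝ, 0 ≤ x → x ≤ 1 → Real.exp x ≤ 1 + x + x ^ 2 := fun x h0 h1 => by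
    have := (abs_le.1 (Real.abs_exp_sub_one_sub_id_le (abs_le.2 ⟨by linarith, h1⟩))).2
    linarith
  have c2 : M2 ≤ 1 + A + A ^ 2 :=
    (Real.prod_one_add_le_exp_sum T fun i => sq_nonneg (μ i)).trans
      (hexp _ hpos.le (by linarith))
  have hq : ∑ i ∈ T, μ i ^ 4 ≤ A ^ 2 := by
    calc ∑ i ∈ T, μ i ^ 4 = ∑ i ∈ T, (μ i ^ 2) * (μ i ^ 2) :=
          Finset.sum_congr rfl fun i _ => by ring
      _ ≤ ∑ i ∈ T, A * (μ i ^ 2) := Finset.sum_le_sum fun i hi =>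
          mul_le_mul_of_nonneg_right
            (Finset.single_le_sum (f := fun i => μ i ^ 2) (fun i _ => sq_nonneg _) hi) (sq_nonneg _)
      _ = A ^ 2 := by rw [← Finset.mul_sum, sq]
  have c4 : M4 ≤ 1 + 6 * A + 39 * A ^ 2 := by
    have e1 : M4 ≤ Real.exp (∑ i ∈ T, (6 * μ i ^ 2 + μ i ^ 4)) :=
      Real.prod_one_add_le_exp_sum T fun i => by positivity
    have e2 : ∑ i ∈ T, (6 * μ i ^ 2 + μ i ^ 4) ≤ 6 * A + A ^ 2 := by
      rw [Finset.sum_add_distrib, ← Finset.mul_sum]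
      linarith
    have e3 := hexp (6 * A + A ^ 2) (by positivity) (by nlinarith)
    have e4 := Real.exp_le_exp.2 e2
    have e5 : A ^ 3 ≤ A ^ 2 / 12 := by nlinarith [sq_nonneg A]
    have e6 : A ^ 4 ≤ A ^ 2 / 12 := by nlinarith [sq_nonneg A, sq_nonneg (A ^ 2)]
    nlinarith
  -- At scale `12 * t` the second moment contributes `t / 12` and the fourth costs at most `45 t /
  -- 1728`; the difference exceeds `t / 20`.
  have key : ∀ x : Cube n, (∏ i ∈ T, (1 + μ i * sgn (x i)) - 1) ^ 2 / (12 * t)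
      - (∏ i ∈ T, (1 + μ i * sgn (x i)) - 1) ^ 4 / (12 * t) ^ 3
      ≤ |∏ i ∈ T, (1 + μ i * sgn (x i)) - 1| := fun x => abs_ge_sq_sub_pow_four (by positivity)
  refine le_trans ?_ (Finset.sum_le_sum fun x _ => key x)
  rw [Finset.sum_sub_distrib, ← Finset.sum_div, ← Finset.sum_div]
  have s2 : ∑ x : Cube n, (∏ i ∈ T, (1 + μ i * sgn (x i)) - 1) ^ 2 = 2 ^ n * (M2 - 1) := by
    have : ∀ x : Cube n, (∏ i ∈ T, (1 + μ i * sgn (x i)) - 1) ^ 2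
        = (∏ i ∈ T, (1 + μ i * sgn (x i))) ^ 2 - 2 * (∏ i ∈ T, (1 + μ i * sgn (x i))) ^ 1 + 1 :=
      fun x => by ring
    simp_rw [this]
    rw [Finset.sum_add_distrib, Finset.sum_sub_distrib, ← Finset.mul_sum, hM, hM, h1, h2]
    simp
    ring
  have s4 : ∑ x : Cube n, (∏ i ∈ T, (1 + μ i * sgn (x i)) - 1) ^ 4
      = 2 ^ n * (M4 - 4 * M3 + 6 * M2 - 3) := by
    have : ∀ x : Cube n, (∏ i ∈ T, (1 + μ i * sgn (x i)) - 1) ^ 4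
        = (∏ i ∈ T, (1 + μ i * sgn (x i))) ^ 4 - 4 * (∏ i ∈ T, (1 + μ i * sgn (x i))) ^ 3
          + 6 * (∏ i ∈ T, (1 + μ i * sgn (x i))) ^ 2
          - 4 * (∏ i ∈ T, (1 + μ i * sgn (x i))) ^ 1 + 1 :=
      fun x => by ring
    simp_rw [this]
    rw [Finset.sum_add_distrib, Finset.sum_sub_distrib, Finset.sum_add_distrib,
      Finset.sum_sub_distrib, ← Finset.mul_sum, ← Finset.mul_sum, ← Finset.mul_sum,
      hM, hM, hM, hM, h1, h2, h3, h4]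
    simp
    ring
  rw [s2, s4, mul_div_assoc, mul_div_assoc, ← mul_sub]
  refine mul_le_mul_of_nonneg_left ?_ (by positivity)
  have f2 : t / 12 ≤ (M2 - 1) / (12 * t) := by
    rw [le_div_iff₀ (by positivity)]
    nlinarith
  -- The constant and linear terms in `A` cancel (`6 - 4 * 3 + 6 = 0`), leaving `39 + 6 = 45` times
  -- `A ^ 2`.
  have f4 : (M4 - 4 * M3 + 6 * M2 - 3) / (12 * t) ^ 3 ≤ t * (45 / 1728) := by
    rw [div_le_iff₀ (by positivity)]
    have : t * (45 / 1728) * (12 * t) ^ 3 = 45 * A ^ 2 := by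
      rw [← htA]
      ring
    rw [this]
    linarith
  linarith

/-- Adding elements one at a time, the first sum to reach `a` overshoots by at most one weight. This
keeps the squared norm of the means in the range where the `L¹` bound applies. -/
theorem exists_subset_sum_between {ι : Type*} (S : Finset ι) {w : ι → ℝ} {a : ℝ}
    (hw : ∀ i, w i ≤ a) (ha : 0 < a) (hS : a ≤ ∑ i ∈ S, w i) :
    ∃ T ⊆ S, a ≤ ∑ i ∈ T, w i ∧ ∑ i ∈ T, w i ≤ 2 * a := by
  classical
  induction S using Finset.induction_on with
  | empty => simp at hS; linarith
  | insert i s hi ih =>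
    by_cases h : a ≤ ∑ i ∈ s, w i
    · obtain ⟨T, hT, h1⟩ := ih h
      exact ⟨T, hT.trans (Finset.subset_insert _ _), h1⟩
    · refine ⟨_, subset_rfl, hS, ?_⟩
      rw [Finset.sum_insert hi]
      linarith [hw i]

theorem sum_toReal_eq_one (p : PMF (Cube n)) : ∑ x, (p x).toReal = 1 := by
  rw [← ENNReal.toReal_sum fun x _ => p.apply_ne_top x,
    ← tsum_fintype (L := SummationFilter.unconditional _), p.tsum_coe, ENNReal.toReal_one]

/-- A product distribution is far from juntas if its means have a large Euclidean norm outside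
every small set of coordinates. -/
theorem isFarFromJunta_meanPMF {k : ℕ} {ε : ℝ} (hε : 0 < ε) (hε' : ε ≤ 1 / 200)
    (μ : Fin n → ℝ) (h : ∀ i, |μ i| < 1) (hmax : ∀ i, μ i ^ 2 ≤ 1600 * ε ^ 2)
    (hsum : ∀ J : Finset (Fin n), J.card ≤ k → 1600 * ε ^ 2 ≤ ∑ i ∈ Jᶜ, μ i ^ 2) :
    IsFarFromJunta k ε (meanPMF μ h) := by
  rintro q ⟨J, hJ, hdep⟩
  obtain ⟨T, hTJ, hT1, hT2⟩ := exists_subset_sum_between Jᶜ hmax (by positivity) (hsum J hJ)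
  set P : Cube n → ℝ := fun x => ∏ i ∈ T, (1 + μ i * sgn (x i)) with hP
  -- The sign of `P - 1` is the optimal test between the marginal of the product distribution on `T`
  -- and the uniform one. A junta on `J` is uniform on `T`, so `φ` has its uniform mean under it.
  set φ : Cube n → ℝ := fun x => if 1 ≤ P x then 1 else -1 with hφ
  have hPT : DependsOn P (T : Set (Fin n)) := fun x y hxy =>
    Finset.prod_congr rfl fun i hi => by rw [hxy i (Finset.mem_coe.2 hi)]
  have hφT : DependsOn φ (T : Set (Fin n)) := fun x y hxy => by
    simp only [hφ, hPT hxy]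
  have hqT : DependsOn (fun x => (q x).toReal) ((T : Set (Fin n))ᶜ) := fun x y hxy => by
    have : q x = q y := hdep fun i hi => hxy i fun hiT => by
      have := hTJ (Finset.mem_coe.1 hiT)
      simp only [Finset.mem_compl] at this
      exact this (Finset.mem_coe.1 hi)
    simp only [this]
  have hq : 2 ^ n * ∑ x, φ x * (q x).toReal = ∑ x, φ x := by
    rw [sum_mul_of_dependsOn hφT hqT, sum_toReal_eq_one, mul_one]
  have hRT : DependsOn (fun x : Cube n => ∏ i ∈ Tᶜ, (1 + μ i * sgn (x i)))
      ((T : Set (Fin n))ᶜ) := fun x y hxy =>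
    Finset.prod_congr rfl fun i hi => by
      rw [hxy i (by simpa using hi)]
  have hp : 2 ^ n * ∑ x, φ x * (meanPMF μ h x).toReal = ∑ x, φ x * P x := by
    set R : Cube n → ℝ := fun x => ∏ i ∈ Tᶜ, (1 + μ i * sgn (x i)) with hR
    have e1 : ∀ x : Cube n, φ x * (meanPMF μ h x).toReal = (φ x * P x) * R x / 2 ^ n := by
      intro x
      rw [meanPMF_toReal, Finset.prod_div_distrib, ← Finset.prod_mul_prod_compl T]
      simp only [hP, hR, Finset.prod_const, Finset.card_univ, Fintype.card_fin]
      ring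
    have e2 : ∑ x, R x = 2 ^ n := by
      rw [hR, sum_prod_subset Tᶜ fun i b => 1 + μ i * sgn b,
        Finset.prod_eq_one fun i _ => by simp; ring, mul_one]
    have e3 := sum_mul_of_dependsOn (f := fun x => φ x * P x) (fun x y hxy => by
      simp only [hPT hxy, hφT hxy]) hRT
    have h2 : (2 : ℝ) ^ n ≠ 0 := by positivity
    simp_rw [e1]
    rw [← Finset.sum_div, mul_div_cancel₀ _ h2]
    rw [e2, mul_comm] at e3
    exact mul_right_cancel₀ h2 e3
  have hpos : ∀ x, φ x * P x - φ x = |P x - 1| := by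
    intro x
    simp only [hφ]
    split_ifs with h1
    · rw [abs_of_nonneg (by linarith)]; ring
    · rw [abs_of_neg (by linarith)]; ring
  have hfar := sum_abs_prod_sub_one_ge T μ (by nlinarith [sq_nonneg ε, pow_pos hε 2])
    (by nlinarith)
  have hle : ∑ x, (φ x * (meanPMF μ h x).toReal - φ x * (q x).toReal)
      ≤ ∑ x, |(meanPMF μ h x).toReal - (q x).toReal| := by
    refine Finset.sum_le_sum fun x _ => ?_
    rw [← mul_sub]
    refine (le_abs_self _).trans ?_
    rw [abs_mul]
    have : |φ x| = 1 := by
      simp only [hφ]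
      split_ifs <;> simp
    rw [this, one_mul]
  have heq : 2 ^ n * ∑ x, (φ x * (meanPMF μ h x).toReal - φ x * (q x).toReal)
      = ∑ x, |P x - 1| := by
    rw [Finset.sum_sub_distrib, mul_sub, hp, hq, ← Finset.sum_sub_distrib]
    exact Finset.sum_congr rfl fun x _ => hpos x
  -- The constant 1600 is `40 ^ 2`: the `L¹` distance is then at least `40 ε / 20 = 2 ε`, and total
  -- variation is half of it.
  have hs : 40 * ε ≤ √(∑ i ∈ T, μ i ^ 2) := Real.le_sqrt_of_sq_le (by nlinarith)
  rw [← heq] at hfar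
  have hfin := (le_of_mul_le_mul_left hfar (by positivity)).trans hle
  rw [dTV]
  linarith

/-! ### Moment matching and chi-squared divergence. -/

/-- For a uniform sign, `(1 + v c) (1 + v' c)` has mean `1 + v v'`. Expanding its `q`-th power
binomially turns the squared norm of a mixture into its moments. -/
theorem sum_sq_sum_mul_prod {ι : Type*} [Fintype ι] (q : ℕ) (u v : ι → ℝ) :
    ∑ c : Fin q → Bool, (∑ j, u j * ∏ t, (1 + v j * sgn (c t))) ^ 2
      = 2 ^ q * ∑ m ∈ Finset.range (q + 1), (q.choose m : ℝ) * (∑ j, u j * v j ^ m) ^ 2 := by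
  have hpair : ∀ j j', ∑ c : Fin q → Bool, (∏ t, (1 + v j * sgn (c t))) * ∏ t, (1 + v j' * sgn (c t))
      = 2 ^ q * ∑ m ∈ Finset.range (q + 1), (q.choose m : ℝ) * (v j ^ m * v j' ^ m) := by
    intro j j'
    simp_rw [← Finset.prod_mul_distrib]
    rw [sum_prod_eq_prod_sum (fun _ b => (1 + v j * sgn b) * (1 + v j' * sgn b))]
    simp only [Fintype.sum_bool, sgn_true, sgn_false, Finset.prod_const, Finset.card_univ,
      Fintype.card_fin]
    rw [show (1 + v j * 1) * (1 + v j' * 1) + (1 + v j * -1) * (1 + v j' * -1)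
      = 2 * (v j * v j' + 1) by ring, mul_pow, add_pow]
    congr 1
    exact Finset.sum_congr rfl fun m _ => by rw [mul_pow, one_pow]; ring
  simp_rw [sq, Finset.sum_mul_sum]
  rw [Finset.sum_comm]
  have h1 : ∀ j, ∑ c : Fin q → Bool, ∑ j', (u j * ∏ t, (1 + v j * sgn (c t)))
      * (u j' * ∏ t, (1 + v j' * sgn (c t)))
      = ∑ j', u j * u j' * (2 ^ q * ∑ m ∈ Finset.range (q + 1),
        (q.choose m : ℝ) * (v j ^ m * v j' ^ m)) := by
    intro j
    rw [Finset.sum_comm]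
    refine Finset.sum_congr rfl fun j' _ => ?_
    rw [← hpair, Finset.mul_sum]
    exact Finset.sum_congr rfl fun c _ => by ring
  simp_rw [h1, Finset.mul_sum]
  conv_rhs => rw [Finset.sum_comm]
  refine Finset.sum_congr rfl fun j _ => ?_
  conv_rhs => rw [Finset.sum_comm]
  refine Finset.sum_congr rfl fun j' _ => Finset.sum_congr rfl fun m _ => ?_
  ring

/-- Two probability vectors `w₀` and `w₁` on an index set that give the nodes `v` the same first
moments, where `w₀` charges an index with node zero. -/
structure MatchedPriors {ι : Type*} [Fintype ι] (v w₀ w₁ : ι → ℝ) (j₀ : ι) (M : ℕ) : Prop where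
  nonneg₀ : ∀ j, 0 ≤ w₀ j
  nonneg₁ : ∀ j, 0 ≤ w₁ j
  sum₀ : ∑ j, w₀ j = 1
  sum₁ : ∑ j, w₁ j = 1
  node : v j₀ = 0
  pos : 0 < w₀ j₀
  moments : ∀ m < M, ∑ j, w₀ j * v j ^ m = ∑ j, w₁ j * v j ^ m

theorem MatchedPriors.scale {ι : Type*} [Fintype ι] {v w₀ w₁ : ι → ℝ} {j₀ : ι} {M : ℕ}
    (h : MatchedPriors v w₀ w₁ j₀ M) (s : ℝ) : MatchedPriors (fun j => s * v j) w₀ w₁ j₀ M where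
  nonneg₀ := h.nonneg₀
  nonneg₁ := h.nonneg₁
  sum₀ := h.sum₀
  sum₁ := h.sum₁
  node := by simp [h.node]
  pos := h.pos
  moments m hm := by
    have h1 : ∀ w : ι → ℝ, ∑ j, w j * (s * v j) ^ m = s ^ m * ∑ j, w j * v j ^ m := fun w => by
      rw [Finset.mul_sum]
      exact Finset.sum_congr rfl fun j _ => by ring
    rw [h1, h1, h.moments m hm]

theorem abs_sum_mul_pow_le {ι : Type*} [Fintype ι] {v w : ι → ℝ} {D : ℝ} (hw : ∀ j, 0 ≤ w j)
    (hsum : ∑ j, w j = 1) (hv : ∀ j, |v j| ≤ D) (m : ℕ) : |∑ j, w j * v j ^ m| ≤ D ^ m := by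
  calc |∑ j, w j * v j ^ m| ≤ ∑ j, |w j * v j ^ m| := Finset.abs_sum_le_sum_abs _ _
    _ ≤ ∑ j, w j * D ^ m := Finset.sum_le_sum fun j _ => by
        rw [abs_mul, abs_of_nonneg (hw j), abs_pow]
        exact mul_le_mul_of_nonneg_left (pow_le_pow_left₀ (abs_nonneg _) (hv j) m) (hw j)
    _ = D ^ m := by rw [← Finset.sum_mul, hsum, one_mul]

/-- Terms of degree below `M` vanish. Beyond, `q.choose m ≤ q ^ m` and a moment difference of at
most `2 D ^ m` leave a geometric series of ratio at most `1/2`. -/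
theorem MatchedPriors.sum_sq_le {ι : Type*} [Fintype ι] {v w₀ w₁ : ι → ℝ} {j₀ : ι} {M : ℕ}
    (h : MatchedPriors v w₀ w₁ j₀ M) {D : ℝ} (hv : ∀ j, |v j| ≤ D) {q : ℕ}
    (hq : q * D ^ 2 ≤ 1 / 2) :
    ∑ c : Fin q → Bool, (∑ j, (w₁ j - w₀ j) * ∏ t, (1 + v j * sgn (c t))) ^ 2
      ≤ 2 ^ q * (8 * (q * D ^ 2) ^ M) := by
  rw [sum_sq_sum_mul_prod]
  refine mul_le_mul_of_nonneg_left ?_ (by positivity)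
  set β := (q : ℝ) * D ^ 2 with hβ
  have hβ0 : 0 ≤ β := by positivity
  have hterm : ∀ m, (q.choose m : ℝ) * (∑ j, (w₁ j - w₀ j) * v j ^ m) ^ 2
      ≤ if M ≤ m then 4 * β ^ M * (1 / 2) ^ (m - M) else 0 := by
    intro m
    have hsub : ∑ j, (w₁ j - w₀ j) * v j ^ m = ∑ j, w₁ j * v j ^ m - ∑ j, w₀ j * v j ^ m := by
      rw [← Finset.sum_sub_distrib]
      exact Finset.sum_congr rfl fun j _ => by ring
    rw [hsub]
    split_ifs with hm
    · have h0 := abs_le.1 (abs_sum_mul_pow_le h.nonneg₀ h.sum₀ hv m)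
      have h1 := abs_le.1 (abs_sum_mul_pow_le h.nonneg₁ h.sum₁ hv m)
      have hsq : (∑ j, w₁ j * v j ^ m - ∑ j, w₀ j * v j ^ m) ^ 2 ≤ (2 * D ^ m) ^ 2 :=
        sq_le_sq' (by linarith [h0.2, h1.1]) (by linarith [h0.1, h1.2])
      have hch : (q.choose m : ℝ) ≤ (q : ℝ) ^ m := by exact_mod_cast Nat.choose_le_pow q m
      calc (q.choose m : ℝ) * (∑ j, w₁ j * v j ^ m - ∑ j, w₀ j * v j ^ m) ^ 2
          ≤ (q : ℝ) ^ m * (2 * D ^ m) ^ 2 := mul_le_mul hch hsq (sq_nonneg _) (by positivity)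
        _ = 4 * β ^ m := by rw [hβ, mul_pow (q : ℝ)]; ring
        _ = 4 * β ^ M * β ^ (m - M) := by rw [mul_assoc, ← pow_add, Nat.add_sub_cancel' hm]
        _ ≤ _ := mul_le_mul_of_nonneg_left (pow_le_pow_left₀ hβ0 hq _) (by positivity)
    · rw [h.moments m (not_le.1 hm)]
      simp
  refine (Finset.sum_le_sum fun m _ => hterm m).trans ?_
  rw [← Finset.sum_filter, ← Finset.mul_sum]
  have hgeo : ∑ m ∈ Finset.range (q + 1) with M ≤ m, (1 / 2 : ℝ) ^ (m - M) ≤ 2 := by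
    have : (Finset.range (q + 1)).filter (fun m => M ≤ m) = Finset.Ico M (q + 1) := by
      ext m
      simp only [Finset.mem_filter, Finset.mem_range, Finset.mem_Ico]
      tauto
    rw [this, Finset.sum_Ico_eq_sum_range]
    simp only [Nat.add_sub_cancel_left]
    exact sum_geometric_two_le _
  nlinarith [pow_nonneg hβ0 M]

/-- Two product measures whose coordinates are close in chi-squared divergence are hard to tell
apart. -/
theorem sum_prod_sub_le_of_chiSq {κ : Type*} [Fintype κ] (φ₀ φ₁ : Fin n → κ → ℝ)
    (hpos : ∀ i c, 0 < φ₀ i c) (h₀ : ∀ i, ∑ c, φ₀ i c = 1) (h₁ : ∀ i, ∑ c, φ₁ i c = 1)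
    (X : Fin n → ℝ) (hX : ∀ i, ∑ c, (φ₁ i c - φ₀ i c) ^ 2 / φ₀ i c ≤ X i)
    (hXsum : ∑ i, X i ≤ 1 / 20) (I : (Fin n → κ) → ℝ) (hI : ∀ z, I z ^ 2 ≤ 1) :
    ∑ z, (∏ i, φ₀ i (z i)) * I z ≤ ∑ z, (∏ i, φ₁ i (z i)) * I z + 1 / 4 := by
  classical
  set F₀ : (Fin n → κ) → ℝ := fun z => ∏ i, φ₀ i (z i) with hF₀
  set F₁ : (Fin n → κ) → ℝ := fun z => ∏ i, φ₁ i (z i) with hF₁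
  have hF₀pos : ∀ z, 0 < F₀ z := fun z => Finset.prod_pos fun i _ => hpos i _
  have hs₀ : ∑ z, F₀ z = 1 := by
    rw [sum_prod_eq_prod_sum, Finset.prod_eq_one fun i _ => h₀ i]
  have hs₁ : ∑ z, F₁ z = 1 := by
    rw [sum_prod_eq_prod_sum, Finset.prod_eq_one fun i _ => h₁ i]
  have hchi : ∀ i, ∑ c, φ₁ i c ^ 2 / φ₀ i c = 1 + ∑ c, (φ₁ i c - φ₀ i c) ^ 2 / φ₀ i c := by
    intro i
    have e : ∀ c, (φ₁ i c - φ₀ i c) ^ 2 / φ₀ i c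
        = φ₁ i c ^ 2 / φ₀ i c - 2 * φ₁ i c + φ₀ i c := fun c => by
      have := (hpos i c).ne'
      field_simp
      ring
    simp_rw [e]
    rw [Finset.sum_add_distrib, Finset.sum_sub_distrib, ← Finset.mul_sum, h₀, h₁]
    ring
  have hprod : ∑ z, F₁ z ^ 2 / F₀ z ≤ Real.exp (1 / 20) := by
    have e : ∀ z, F₁ z ^ 2 / F₀ z = ∏ i, (φ₁ i (z i) ^ 2 / φ₀ i (z i)) := fun z => by
      rw [Finset.prod_div_distrib, Finset.prod_pow]
    simp_rw [e]
    rw [sum_prod_eq_prod_sum (fun i c => φ₁ i c ^ 2 / φ₀ i c)]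
    simp_rw [hchi]
    refine (Real.prod_one_add_le_exp_sum Finset.univ fun i => Finset.sum_nonneg fun c _ =>
      div_nonneg (sq_nonneg _) (hpos i c).le).trans (Real.exp_le_exp.2 ?_)
    exact (Finset.sum_le_sum fun i _ => hX i).trans hXsum
  -- The divergence is kept below `1/16` because Cauchy–Schwarz takes its square root, giving
  -- advantage `1/4`.
  have hexp : Real.exp (1 / 20) ≤ 1 + 1 / 16 := by
    have := (abs_le.1 (Real.abs_exp_sub_one_sub_id_le (x := 1 / 20) (by norm_num [abs_le]))).2
    norm_num at this ⊢
    linarith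
  have hdist : ∑ z, (F₀ z - F₁ z) ^ 2 / F₀ z ≤ 1 / 16 := by
    have e : ∀ z, (F₀ z - F₁ z) ^ 2 / F₀ z = F₁ z ^ 2 / F₀ z - 2 * F₁ z + F₀ z := fun z => by
      have := (hF₀pos z).ne'
      field_simp
      ring
    simp_rw [e]
    rw [Finset.sum_add_distrib, Finset.sum_sub_distrib, ← Finset.mul_sum, hs₀, hs₁]
    linarith
  have hCS := Finset.sum_sq_le_sum_mul_sum_of_sq_le_mul Finset.univ
    (r := fun z => (F₀ z - F₁ z) * I z) (f := fun z => (F₀ z - F₁ z) ^ 2 / F₀ z) (g := F₀)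
    (fun z _ => div_nonneg (sq_nonneg _) (hF₀pos z).le) (fun z _ => (hF₀pos z).le)
    (fun z _ => by
      rw [div_mul_cancel₀ _ (hF₀pos z).ne', mul_pow]
      exact mul_le_of_le_one_right (sq_nonneg _) (hI z))
  rw [hs₀, mul_one] at hCS
  have hle : ∑ z, (F₀ z - F₁ z) * I z ≤ 1 / 4 :=
    abs_le_of_sq_le_sq' (by linarith) (by norm_num) |>.2
  simp_rw [sub_mul, Finset.sum_sub_distrib] at hle
  linarith

/-! ### Indistinguishability of the two mixtures. -/

/-- The means that are drawn from the nodes `v` on the coordinates in `B` and vanish elsewhere. -/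
def nodeMeans {ι : Type*} (B : Finset (Fin n)) (v : ι → ℝ) (a : Fin n → ι) (i : Fin n) : ℝ :=
  if i ∈ B then v (a i) else 0

theorem abs_nodeMeans_lt_one {ι : Type*} (B : Finset (Fin n)) {v : ι → ℝ} (hv : ∀ j, |v j| < 1)
    (a : Fin n → ι) (i : Fin n) : |nodeMeans B v a i| < 1 := by
  unfold nodeMeans
  split_ifs
  · exact hv _
  · simp

theorem sum_prior_mul_prod_meanPMF {ι : Type*} [Fintype ι] [DecidableEq ι] (B : Finset (Fin n))
    {v : ι → ℝ} (hv : ∀ j, |v j| < 1) (w : ι → ℝ) {q : ℕ} (y : Fin q → Cube n) :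
    ∑ a : Fin n → ι, (∏ i, w (a i)) *
        ∏ t, (meanPMF (nodeMeans B v a) (abs_nodeMeans_lt_one B hv a) (y t)).toReal
      = ∏ i, ((∑ j, w j * ∏ t, (1 + (if i ∈ B then v j else 0) * sgn (y t i))) / 2 ^ q) := by
  simp_rw [meanPMF_toReal]
  have e : ∀ a : Fin n → ι, (∏ i, w (a i)) * ∏ t, ∏ i, (1 + nodeMeans B v a i * sgn (y t i)) / 2
      = ∏ i, (w (a i) * ∏ t, (1 + (if i ∈ B then v (a i) else 0) * sgn (y t i))) / 2 ^ q := by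
    intro a
    rw [Finset.prod_comm, ← Finset.prod_mul_distrib]
    refine Finset.prod_congr rfl fun i _ => ?_
    rw [Finset.prod_div_distrib]
    simp only [nodeMeans, Finset.prod_const, Finset.card_univ, Fintype.card_fin]
    ring
  simp_rw [e]
  rw [sum_prod_eq_prod_sum (fun i j =>
    (w j * ∏ t, (1 + (if i ∈ B then v j else 0) * sgn (y t i))) / 2 ^ q)]
  simp_rw [Finset.sum_div]

/-- A test that sees `q` samples cannot tell apart the two mixtures of product distributions. -/
theorem MatchedPriors.test_le {ι : Type*} [Fintype ι] [DecidableEq ι] {v w₀ w₁ : ι → ℝ} {j₀ : ι}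
    {M : ℕ} (h : MatchedPriors v w₀ w₁ j₀ M) (hv1 : ∀ j, |v j| < 1) {D : ℝ}
    (hv : ∀ j, |v j| ≤ D) {q : ℕ} (hq : q * D ^ 2 ≤ 1 / 2) (B : Finset (Fin n))
    (hB : B.card * (8 * (q * D ^ 2) ^ M / w₀ j₀) ≤ 1 / 20) (I : (Fin q → Cube n) → ℝ)
    (hI : ∀ y, I y ^ 2 ≤ 1) :
    ∑ a : Fin n → ι, (∏ i, w₀ (a i)) * ∑ y, (∏ t, (meanPMF (nodeMeans B v a)
        (abs_nodeMeans_lt_one B hv1 a) (y t)).toReal) * I y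
      ≤ ∑ a : Fin n → ι, (∏ i, w₁ (a i)) * ∑ y, (∏ t, (meanPMF (nodeMeans B v a)
        (abs_nodeMeans_lt_one B hv1 a) (y t)).toReal) * I y + 1 / 4 := by
  set φ : (ι → ℝ) → Fin n → (Fin q → Bool) → ℝ := fun w i c =>
    (∑ j, w j * ∏ t, (1 + (if i ∈ B then v j else 0) * sgn (c t))) / 2 ^ q with hφ
  have hmix : ∀ w : ι → ℝ, ∑ a : Fin n → ι, (∏ i, w (a i)) * ∑ y, (∏ t, (meanPMF
      (nodeMeans B v a) (abs_nodeMeans_lt_one B hv1 a) (y t)).toReal) * I y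
      = ∑ z : Fin n → Fin q → Bool, (∏ i, φ w i (z i)) * I (fun t i => z i t) := by
    intro w
    simp_rw [Finset.mul_sum, ← mul_assoc]
    -- The samples are transposed: within a mixture, the columns of `q` signs belonging to different
    -- coordinates are independent.
    rw [Finset.sum_comm, ← Equiv.sum_comp (Equiv.piComm fun (_ : Fin n) (_ : Fin q) => Bool)]
    refine Finset.sum_congr rfl fun z _ => ?_
    rw [← Finset.sum_mul, sum_prior_mul_prod_meanPMF B hv1 w]
    rfl
  rw [hmix, hmix]
  have hm1 : ∀ i j, |if i ∈ B then v j else 0| < 1 := fun i j => by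
    split_ifs
    · exact hv1 j
    · simp
  have hsum : ∀ w : ι → ℝ, ∑ j, w j = 1 → ∀ i, ∑ c, φ w i c = 1 := by
    intro w hw i
    simp only [hφ]
    rw [← Finset.sum_div, Finset.sum_comm]
    have e : ∀ j, ∑ c : Fin q → Bool, w j * ∏ t, (1 + (if i ∈ B then v j else 0) * sgn (c t))
        = w j * 2 ^ q := fun j => by
      rw [← Finset.mul_sum, sum_prod_eq_prod_sum
        (fun _ b => 1 + (if i ∈ B then v j else 0) * sgn b)]
      simp only [Fintype.sum_bool, sgn_true, sgn_false, Finset.prod_const, Finset.card_univ,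
        Fintype.card_fin]
      congr 2
      ring
    simp_rw [e]
    rw [← Finset.sum_mul, hw, one_mul, div_self (by positivity)]
  -- The node zero contributes `w₀ j₀` times the uniform law, so the chi-squared denominator can be
  -- replaced by a constant.
  have hlow : ∀ i c, w₀ j₀ / 2 ^ q ≤ φ w₀ i c := by
    intro i c
    refine div_le_div_of_nonneg_right ?_ (by positivity)
    have := Finset.single_le_sum (f := fun j => w₀ j *
      ∏ t, (1 + (if i ∈ B then v j else 0) * sgn (c t))) (fun j _ => mul_nonneg (h.nonneg₀ j)
        (Finset.prod_nonneg fun t _ => (one_add_mul_sgn_pos (hm1 i j) _).le))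
      (Finset.mem_univ j₀)
    simpa [h.node] using this
  have hpos : ∀ i c, 0 < φ w₀ i c := fun i c =>
    lt_of_lt_of_le (div_pos h.pos (by positivity)) (hlow i c)
  refine sum_prod_sub_le_of_chiSq (φ w₀) (φ w₁) hpos (hsum w₀ h.sum₀) (hsum w₁ h.sum₁)
    (fun i => if i ∈ B then 8 * (q * D ^ 2) ^ M / w₀ j₀ else 0) ?_ ?_ _ fun z => hI _
  · intro i
    split_ifs with hi
    · calc ∑ c, (φ w₁ i c - φ w₀ i c) ^ 2 / φ w₀ i c
          ≤ ∑ c, (φ w₁ i c - φ w₀ i c) ^ 2 / (w₀ j₀ / 2 ^ q) :=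
            Finset.sum_le_sum fun c _ => div_le_div_of_nonneg_left (sq_nonneg _)
              (div_pos h.pos (by positivity)) (hlow i c)
        _ = (∑ c : Fin q → Bool, (∑ j, (w₁ j - w₀ j) * ∏ t, (1 + v j * sgn (c t))) ^ 2)
              / 2 ^ q / w₀ j₀ := by
            rw [Finset.sum_div, Finset.sum_div]
            refine Finset.sum_congr rfl fun c _ => ?_
            simp only [hφ, if_pos hi, sub_mul, Finset.sum_sub_distrib]
            have := h.pos.ne'
            field_simp
        _ ≤ 2 ^ q * (8 * (q * D ^ 2) ^ M) / 2 ^ q / w₀ j₀ := by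
            have := h.sum_sq_le hv hq
            have := h.pos.le
            gcongr
        _ = _ := by rw [mul_div_cancel_left₀ _ (by positivity)]
    · refine (Finset.sum_eq_zero fun c _ => ?_).le
      simp [hφ, if_neg hi, h.sum₀, h.sum₁]
  · rw [Finset.sum_ite_mem]
    simpa using hB

theorem run_meanPMF_toReal {q : ℕ} {T : DetAlg n} (hT : T.queries ≤ q) :
    ∃ I : (Fin q → Cube n) → ℝ, (∀ y, I y ^ 2 ≤ 1) ∧
      ∀ (μ : Fin n → ℝ) (h : ∀ i, |μ i| < 1),
        (T.run (meanPMF μ h) true).toReal = ∑ y, (∏ t, (meanPMF μ h (y t)).toReal) * I y := by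
  obtain ⟨G, hG⟩ := exists_test_of_detAlg q T hT
  refine ⟨fun y => if G y = true then 1 else 0, fun y => by by_cases hy : G y = true <;> simp [hy], fun μ h => ?_⟩
  rw [meanPMF, hG _ (fun i b => signPMF_ne_zero (h i) b) true, ENNReal.toReal_sum]
  · refine Finset.sum_congr rfl fun y _ => ?_
    rw [ENNReal.toReal_mul, ENNReal.toReal_prod]
    by_cases hy : G y = true <;> simp [hy]
  · intro y _
    refine ENNReal.mul_ne_top (ENNReal.prod_ne_top fun t _ => PMF.apply_ne_top _ _) ?_
    split_ifs <;> simp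

/-- Passing from deterministic to randomized algorithms in an inequality between averages of
acceptance probabilities. -/
theorem RandAlg.sum_run_le {α : Type*} [Fintype α] (p : α → PMF (Cube n)) (W₀ W₁ : α → ℝ)
    (h₀ : ∀ a, 0 ≤ W₀ a) (h₁ : ∀ a, 0 ≤ W₁ a) {A : RandAlg n} {q : ℕ} (hA : A.MakesAtMost q)
    {τ : ℝ} (hτ : 0 ≤ τ)
    (hT : ∀ T : DetAlg n, T.queries ≤ q →
      ∑ a, W₀ a * (T.run (p a) true).toReal ≤ ∑ a, W₁ a * (T.run (p a) true).toReal + τ) :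
    ∑ a, W₀ a * (A.run (p a) true).toReal ≤ ∑ a, W₁ a * (A.run (p a) true).toReal + τ := by
  have hof : ∀ (W : α → ℝ), (∀ a, 0 ≤ W a) → ∀ r : α → PMF Bool,
      ENNReal.ofReal (∑ a, W a * (r a true).toReal) = ∑ a, ENNReal.ofReal (W a) * r a true := by
    intro W hW r
    rw [ENNReal.ofReal_sum_of_nonneg fun a _ => mul_nonneg (hW a) ENNReal.toReal_nonneg]
    refine Finset.sum_congr rfl fun a _ => ?_
    rw [ENNReal.ofReal_mul (hW a), ENNReal.ofReal_toReal (PMF.apply_ne_top _ _)]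
  have hswap : ∀ W : α → ℝ, ∑ a, ENNReal.ofReal (W a) * A.run (p a) true
      = ∑' T, A T * ∑ a, ENNReal.ofReal (W a) * T.run (p a) true := by
    intro W
    simp_rw [RandAlg.run, PMF.bind_apply, ← ENNReal.tsum_mul_left, Finset.mul_sum]
    rw [Summable.tsum_finsetSum fun _ _ => ENNReal.summable]
    exact Finset.sum_congr rfl fun a _ => tsum_congr fun T => by ring
  have hnn : 0 ≤ ∑ a, W₁ a * (A.run (p a) true).toReal :=
    Finset.sum_nonneg fun a _ => mul_nonneg (h₁ a) ENNReal.toReal_nonneg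
  rw [← ENNReal.ofReal_le_ofReal_iff (by positivity), ENNReal.ofReal_add hnn hτ,
    hof W₀ h₀ fun a => A.run (p a), hof W₁ h₁ fun a => A.run (p a), hswap, hswap]
  calc ∑' T, A T * ∑ a, ENNReal.ofReal (W₀ a) * T.run (p a) true
      ≤ ∑' T, (A T * ∑ a, ENNReal.ofReal (W₁ a) * T.run (p a) true
          + A T * ENNReal.ofReal τ) := by
        refine ENNReal.tsum_le_tsum fun T => ?_
        by_cases hTA : T ∈ A.support
        · rw [← mul_add]
          refine mul_le_mul_right ?_ _
          have hnn' : 0 ≤ ∑ a, W₁ a * (T.run (p a) true).toReal :=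
            Finset.sum_nonneg fun a _ => mul_nonneg (h₁ a) ENNReal.toReal_nonneg
          rw [← hof W₀ h₀ fun a => T.run (p a), ← hof W₁ h₁ fun a => T.run (p a),
            ← ENNReal.ofReal_add hnn' hτ]
          exact ENNReal.ofReal_le_ofReal (hT T (hA T hTA))
        · rw [(PMF.apply_eq_zero_iff A T).2 hTA]
          simp
    _ = _ := by rw [ENNReal.tsum_add, ENNReal.tsum_mul_right, A.tsum_coe, one_mul]

/-- No algorithm with `q` queries is a tester if the mixture with weights `w₀` is mostly supported
on juntas and that with weights `w₁` on distributions far from juntas. -/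
theorem MatchedPriors.not_isJuntaTester {ι : Type*} [Fintype ι] [DecidableEq ι] {v w₀ w₁ : ι → ℝ}
    {j₀ : ι} {M : ℕ} (h : MatchedPriors v w₀ w₁ j₀ M) (hv1 : ∀ j, |v j| < 1) {D : ℝ}
    (hv : ∀ j, |v j| ≤ D) {q : ℕ} (hq : q * D ^ 2 ≤ 1 / 2) (B : Finset (Fin n))
    (hB : B.card * (8 * (q * D ^ 2) ^ M / w₀ j₀) ≤ 1 / 20) {k : ℕ} {ε : ℝ}
    (hyes : ∑ a : Fin n → ι, (∏ i, w₀ (a i)) *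
      (if (Finset.univ.filter fun i => nodeMeans B v a i ≠ 0).card ≤ k then 0 else 1) ≤ 1 / 12)
    (hno : ∀ a : Fin n → ι, (∀ i, w₁ (a i) ≠ 0) →
      IsFarFromJunta k ε (meanPMF (nodeMeans B v a) (abs_nodeMeans_lt_one B hv1 a)))
    {A : RandAlg n} (hA : A.MakesAtMost q) : ¬ IsJuntaTester {p | IsProduct p} k ε A := by
  intro htest
  set p : (Fin n → ι) → PMF (Cube n) := fun a =>
    meanPMF (nodeMeans B v a) (abs_nodeMeans_lt_one B hv1 a) with hp
  have hW₀ : ∀ a : Fin n → ι, 0 ≤ ∏ i, w₀ (a i) := fun a =>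
    Finset.prod_nonneg fun i _ => h.nonneg₀ _
  have hW₁ : ∀ a : Fin n → ι, 0 ≤ ∏ i, w₁ (a i) := fun a =>
    Finset.prod_nonneg fun i _ => h.nonneg₁ _
  have hs₀ : ∑ a : Fin n → ι, ∏ i, w₀ (a i) = 1 := by
    rw [sum_prod_eq_prod_sum (fun _ j => w₀ j), Finset.prod_eq_one fun i _ => h.sum₀]
  have hs₁ : ∑ a : Fin n → ι, ∏ i, w₁ (a i) = 1 := by
    rw [sum_prod_eq_prod_sum (fun _ j => w₁ j), Finset.prod_eq_one fun i _ => h.sum₁]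
  have hcmp := RandAlg.sum_run_le p (fun a => ∏ i, w₀ (a i)) (fun a => ∏ i, w₁ (a i)) hW₀ hW₁ hA
    (τ := 1 / 4) (by norm_num) fun T hT => by
      obtain ⟨I, hI, hrun⟩ := run_meanPMF_toReal hT
      simp only [hp, hrun]
      exact h.test_le hv1 hv hq B hB I hI
  have hprod : ∀ a, IsProduct (p a) := fun a => isProduct_productPMF _
  have hlow : 2 / 3 * (1 - 1 / 12) ≤ ∑ a, (∏ i, w₀ (a i)) * (A.run (p a) true).toReal := by
    have hterm : ∀ a, (∏ i, w₀ (a i)) * (2 / 3) - 2 / 3 * ((∏ i, w₀ (a i)) *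
        (if (Finset.univ.filter fun i => nodeMeans B v a i ≠ 0).card ≤ k then 0 else 1))
        ≤ (∏ i, w₀ (a i)) * (A.run (p a) true).toReal := by
      intro a
      split_ifs with hk
      · have h1 := (htest (p a) (hprod a)).1 (isJunta_meanPMF _ _ hk)
        have h2 := ENNReal.toReal_mono (PMF.apply_ne_top _ _) h1
        rw [ENNReal.toReal_div] at h2
        simp only [ENNReal.toReal_ofNat] at h2
        nlinarith [mul_le_mul_of_nonneg_left h2 (hW₀ a)]
      · have := mul_nonneg (hW₀ a) (ENNReal.toReal_nonneg (a := A.run (p a) true))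
        linarith
    refine le_trans ?_ (Finset.sum_le_sum fun a _ => hterm a)
    rw [Finset.sum_sub_distrib, ← Finset.sum_mul, hs₀, ← Finset.mul_sum]
    linarith
  have hupp : ∑ a, (∏ i, w₁ (a i)) * (A.run (p a) true).toReal ≤ 1 / 3 := by
    have hterm : ∀ a, (∏ i, w₁ (a i)) * (A.run (p a) true).toReal ≤ (∏ i, w₁ (a i)) * (1 / 3) := by
      intro a
      by_cases ha : ∀ i, w₁ (a i) ≠ 0
      · refine mul_le_mul_of_nonneg_left ?_ (hW₁ a)
        have h1 := (htest (p a) (hprod a)).2 (hno a ha)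
        have h2 := ENNReal.toReal_mono (PMF.apply_ne_top _ _) h1
        rw [ENNReal.toReal_div] at h2
        simp only [ENNReal.toReal_ofNat] at h2
        have h3 := (A.run (p a)).tsum_coe
        rw [tsum_fintype, Fintype.sum_bool] at h3
        have h4 := congrArg ENNReal.toReal h3
        rw [ENNReal.toReal_add (PMF.apply_ne_top _ _) (PMF.apply_ne_top _ _),
          ENNReal.toReal_one] at h4
        linarith
      · push Not at ha
        obtain ⟨i, hi⟩ := ha
        rw [Finset.prod_eq_zero (Finset.mem_univ i) hi]
        simp
    refine (Finset.sum_le_sum fun a _ => hterm a).trans ?_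
    rw [← Finset.sum_mul, hs₁, one_mul]
  -- The contradiction is `2/3 * 11/12 = 11/18 > 7/12 = 1/3 + 1/4`.
  linarith

/-- With high probability, a random assignment of nodes has few nonzero means. -/
theorem MatchedPriors.sum_card_gt_le {ι : Type*} [Fintype ι] [DecidableEq ι] {v w₀ w₁ : ι → ℝ}
    {j₀ : ι} {M : ℕ} (h : MatchedPriors v w₀ w₁ j₀ M) (B : Finset (Fin n)) {k m : ℕ}
    (hcard : B.card ≤ k + m) (hm : 4 * (m : ℝ) ≤ B.card * w₀ j₀) (hm' : 11 ≤ m) :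
    ∑ a : Fin n → ι, (∏ i, w₀ (a i)) *
      (if (Finset.univ.filter fun i => nodeMeans B v a i ≠ 0).card ≤ k then 0 else 1)
      ≤ 1 / 12 := by
  have hW : ∀ a : Fin n → ι, 0 ≤ ∏ i, w₀ (a i) := fun a =>
    Finset.prod_nonneg fun i _ => h.nonneg₀ _
  -- Exponential Markov bound: more than `k` nonzero means leave at most `m` indices of `B` at `j₀`,
  -- so `2 ^ m` times `(1/2)` to their number is at least 1.
  have hind : ∀ a : Fin n → ι,
      (if (Finset.univ.filter fun i => nodeMeans B v a i ≠ 0).card ≤ k then (0 : ℝ) else 1)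
      ≤ 2 ^ m * ∏ i, (if i ∈ B ∧ a i = j₀ then (1 / 2 : ℝ) else 1) := by
    intro a
    split_ifs with hk
    · exact mul_nonneg (by positivity) (Finset.prod_nonneg fun i _ => by split_ifs <;> norm_num)
    · rw [← Finset.prod_filter, Finset.prod_const]
      set Z := Finset.univ.filter fun i => i ∈ B ∧ a i = j₀
      have hZB : Z ⊆ B := fun i hi => (Finset.mem_filter.1 hi).2.1
      have hsub : (Finset.univ.filter fun i => nodeMeans B v a i ≠ 0) ⊆ B \ Z := by
        intro i hi
        have hi' := (Finset.mem_filter.1 hi).2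
        have hiB : i ∈ B := by
          by_contra hiB
          exact hi' (if_neg hiB)
        rw [nodeMeans, if_pos hiB] at hi'
        rw [Finset.mem_sdiff]
        refine ⟨hiB, fun hiZ => hi' ?_⟩
        rw [(Finset.mem_filter.1 hiZ).2.2, h.node]
      have hc := Finset.card_le_card hsub
      rw [Finset.card_sdiff_of_subset hZB] at hc
      have hZm : Z.card ≤ m := by omega
      calc (1 : ℝ) = 2 ^ m * (1 / 2) ^ m := by rw [← mul_pow]; norm_num
        _ ≤ 2 ^ m * (1 / 2) ^ Z.card := mul_le_mul_of_nonneg_left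
            (pow_le_pow_of_le_one (by norm_num) (by norm_num) hZm) (by positivity)
  have hsum : ∑ a : Fin n → ι, (∏ i, w₀ (a i)) * ∏ i, (if i ∈ B ∧ a i = j₀ then (1 / 2 : ℝ) else 1)
      = (1 - w₀ j₀ / 2) ^ B.card := by
    simp_rw [← Finset.prod_mul_distrib]
    rw [sum_prod_eq_prod_sum (fun i j => w₀ j * (if i ∈ B ∧ j = j₀ then (1 / 2 : ℝ) else 1)),
      ← Finset.prod_const, ← Finset.prod_ite_mem_eq B fun _ => 1 - w₀ j₀ / 2]
    refine Finset.prod_congr rfl fun i _ => ?_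
    split_ifs with hi
    · have e : ∀ j, w₀ j * (if i ∈ B ∧ j = j₀ then (1 / 2 : ℝ) else 1)
          = w₀ j - if j = j₀ then w₀ j / 2 else 0 := fun j => by
        by_cases hj : j = j₀
        · simp [hi, hj]
          ring
        · simp [hj]
      simp_rw [e]
      rw [Finset.sum_sub_distrib, h.sum₀, Finset.sum_ite_eq' Finset.univ j₀ fun j => w₀ j / 2]
      simp
    · simp [hi, h.sum₀]
  have hle1 : w₀ j₀ ≤ 1 := by
    rw [← h.sum₀]
    exact Finset.single_le_sum (fun j _ => h.nonneg₀ j) (Finset.mem_univ j₀)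
  have hexp : (1 - w₀ j₀ / 2) ^ B.card ≤ Real.exp (-(2 * m)) := by
    calc (1 - w₀ j₀ / 2) ^ B.card ≤ Real.exp (-(w₀ j₀ / 2)) ^ B.card :=
          pow_le_pow_left₀ (by linarith) (Real.one_sub_le_exp_neg _) _
      _ = Real.exp (B.card * -(w₀ j₀ / 2)) := (Real.exp_nat_mul _ _).symm
      _ ≤ _ := Real.exp_le_exp.2 (by linarith)
  have h2 : (2 : ℝ) ^ m ≤ Real.exp m := by
    rw [show Real.exp m = Real.exp 1 ^ m by rw [← Real.exp_nat_mul, mul_one]]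
    exact pow_le_pow_left₀ zero_le_two (by linarith [Real.add_one_le_exp (1 : ℝ)]) _
  have hm12 : (12 : ℝ) ≤ Real.exp m := by
    have h11 : (11 : ℝ) ≤ m := by exact_mod_cast hm'
    linarith [Real.add_one_le_exp (m : ℝ)]
  calc _ ≤ ∑ a : Fin n → ι, (∏ i, w₀ (a i)) *
          (2 ^ m * ∏ i, (if i ∈ B ∧ a i = j₀ then (1 / 2 : ℝ) else 1)) :=
        Finset.sum_le_sum fun a _ => mul_le_mul_of_nonneg_left (hind a) (hW a)
    _ = 2 ^ m * (1 - w₀ j₀ / 2) ^ B.card := by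
        rw [← hsum, Finset.mul_sum]
        exact Finset.sum_congr rfl fun a _ => by ring
    _ ≤ Real.exp m * Real.exp (-(2 * m)) :=
        mul_le_mul h2 hexp (pow_nonneg (by linarith) _) (Real.exp_pos _).le
    _ = (Real.exp m)⁻¹ := by rw [← Real.exp_add, ← Real.exp_neg]; ring_nf
    _ ≤ 12⁻¹ := inv_anti₀ (by norm_num) hm12
    _ = 1 / 12 := by norm_num

/-! ### Binomial priors. -/

/-- The integers from `-L` to `L`. -/
def centeredNode (L : ℕ) (j : Fin (2 * L + 1)) : ℝ := (j : ℝ) - L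

/-- The binomial distribution on the integers from `-L` to `L`, restricted to the even integers. -/
noncomputable def evenWeight (L : ℕ) (j : Fin (2 * L + 1)) : ℝ :=
  if Even ((j : ℕ) + L) then 2 * ((2 * L).choose j : ℝ) / 4 ^ L else 0

/-- The binomial distribution on the integers from `-L` to `L`, restricted to the odd integers. -/
noncomputable def oddWeight (L : ℕ) (j : Fin (2 * L + 1)) : ℝ :=
  if Even ((j : ℕ) + L) then 0 else 2 * ((2 * L).choose j : ℝ) / 4 ^ L

/-- The index of the integer zero. -/
def zeroIndex (L : ℕ) : Fin (2 * L + 1) := ⟨L, by omega⟩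

/-- The central binomial coefficient is at least `4 ^ L / (2 L)`. This is the probability with which
the yes-prior kills a coordinate. -/
theorem evenWeight_zeroIndex_ge {L : ℕ} (hL : 1 ≤ L) :
    1 / (L : ℝ) ≤ evenWeight L (zeroIndex L) := by
  have hL' : (0 : ℝ) < L := by exact_mod_cast hL
  have h := Nat.four_pow_le_two_mul_self_mul_centralBinom L hL
  have h' : (4 : ℝ) ^ L ≤ 2 * L * Nat.centralBinom L := by exact_mod_cast h
  rw [Nat.centralBinom_eq_two_mul_choose] at h'
  rw [evenWeight, if_pos (show Even ((zeroIndex L : ℕ) + L) from ⟨L, rfl⟩)]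
  change 1 / (L : ℝ) ≤ 2 * ((2 * L).choose L : ℝ) / 4 ^ L
  rw [div_le_div_iff₀ hL' (by positivity)]
  linarith

/-- Up to a constant the difference of weights is `(-1) ^ j * (2 * L).choose j`, and a finite
difference of order `2 * L` annihilates polynomials of lower degree. -/
theorem sum_evenWeight_sub_oddWeight {L m : ℕ} (hm : m < 2 * L) :
    ∑ j, (evenWeight L j - oddWeight L j) * centeredNode L j ^ m = 0 := by
  have h := congrFun (fwdDiff_iter_pow_eq_zero_of_lt (R := ℝ) hm) (-L)
  rw [fwdDiff_iter_eq_sum_shift, Finset.sum_range] at h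
  have e : ∀ j : Fin (2 * L + 1), (evenWeight L j - oddWeight L j) * centeredNode L j ^ m
      = (2 * (-1) ^ L / 4 ^ L) * (((-1 : ℤ) ^ (2 * L - j) * (2 * L).choose j)
        • (-(L : ℝ) + (j : ℕ) • (1 : ℝ)) ^ m) := by
    intro j
    have hj : (j : ℕ) ≤ 2 * L := by omega
    have hs : (-1 : ℝ) ^ (2 * L - (j : ℕ)) = (-1) ^ (j : ℕ) := by
      rw [neg_one_pow_eq_pow_mod_two, neg_one_pow_eq_pow_mod_two (n := (j : ℕ))]
      congr 1
      omega
    have hw : evenWeight L j - oddWeight L j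
        = 2 * (-1) ^ L / 4 ^ L * ((-1) ^ (j : ℕ) * ((2 * L).choose j : ℝ)) := by
      have h1 : (2 : ℝ) * (-1) ^ L / 4 ^ L * ((-1) ^ (j : ℕ) * ((2 * L).choose j : ℝ))
          = (-1) ^ ((j : ℕ) + L) * (2 * ((2 * L).choose j : ℝ) / 4 ^ L) := by
        rw [pow_add]
        ring
      rw [h1, evenWeight, oddWeight]
      by_cases hev : Even ((j : ℕ) + L)
      · simp [hev]
      · rw [if_neg hev, if_neg hev, (Nat.not_even_iff_odd.1 hev).neg_one_pow]
        ring
    rw [hw, centeredNode, zsmul_eq_mul, nsmul_eq_mul]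
    push_cast
    rw [hs]
    ring
  simp_rw [e]
  rw [← Finset.mul_sum, h]
  simp

theorem matchedPriors_binomial {L : ℕ} (hL : 1 ≤ L) :
    MatchedPriors (centeredNode L) (evenWeight L) (oddWeight L) (zeroIndex L) (2 * L) := by
  have hadd : ∑ j, evenWeight L j + ∑ j, oddWeight L j = 2 := by
    rw [← Finset.sum_add_distrib]
    have e : ∀ j : Fin (2 * L + 1), evenWeight L j + oddWeight L j
        = 2 / 4 ^ L * ((2 * L).choose j : ℝ) := fun j => by
      rw [evenWeight, oddWeight]
      split_ifs <;> ring
    simp_rw [e]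
    rw [← Finset.mul_sum, ← Finset.sum_range (fun j => ((2 * L).choose j : ℝ))]
    have := Nat.sum_range_choose (2 * L)
    rw [pow_mul] at this
    have h' : ∑ j ∈ Finset.range (2 * L + 1), ((2 * L).choose j : ℝ) = 4 ^ L := by
      exact_mod_cast this
    rw [h', div_mul_cancel₀ _ (by positivity)]
  have hmom : ∀ m < 2 * L, ∑ j, evenWeight L j * centeredNode L j ^ m
      = ∑ j, oddWeight L j * centeredNode L j ^ m := by
    intro m hm
    have := sum_evenWeight_sub_oddWeight hm
    simp_rw [sub_mul, Finset.sum_sub_distrib] at this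
    linarith
  have hzero : ∑ j, evenWeight L j = ∑ j, oddWeight L j := by
    simpa using hmom 0 (by omega)
  exact
    { nonneg₀ := fun j => by rw [evenWeight]; split_ifs <;> positivity
      nonneg₁ := fun j => by rw [oddWeight]; split_ifs <;> positivity
      sum₀ := by linarith
      sum₁ := by linarith
      node := by simp [centeredNode, zeroIndex]
      pos := lt_of_lt_of_le (by positivity) (evenWeight_zeroIndex_ge hL)
      moments := hmom }

theorem abs_centeredNode_le (L : ℕ) (j : Fin (2 * L + 1)) : |centeredNode L j| ≤ L := by
  have hj : (j : ℝ) ≤ 2 * L := by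
    have : (j : ℕ) ≤ 2 * L := by omega
    exact_mod_cast this
  have hj0 : (0 : ℝ) ≤ j := by positivity
  rw [centeredNode, abs_le]
  constructor <;> linarith

theorem one_le_centeredNode_sq {L : ℕ} {j : Fin (2 * L + 1)} (hj : oddWeight L j ≠ 0) :
    1 ≤ centeredNode L j ^ 2 := by
  have hne : (j : ℤ) - L ≠ 0 := by
    intro h
    have : (j : ℕ) = L := by omega
    exact hj (if_pos (by rw [this]; exact ⟨L, rfl⟩))
  have h1 : (1 : ℤ) ≤ ((j : ℤ) - L) ^ 2 := by
    have := sq_nonneg ((j : ℤ) - L)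
    have := pow_ne_zero 2 hne
    omega
  rw [centeredNode]
  exact_mod_cast h1

/-- The lower bound obtained from binomial priors of degree `L` and scale `δ` on the coordinates
in `B`. -/
theorem not_isJuntaTester_of_binomial {L : ℕ} (hL : 1 ≤ L) {δ ε : ℝ} (hε : 0 < ε)
    (hε' : ε ≤ 1 / 200) {k q : ℕ} (B : Finset (Fin n))
    (hmax : (L * δ) ^ 2 ≤ 1600 * ε ^ 2) (hmin : 1600 * ε ^ 2 ≤ (B.card - k : ℝ) * δ ^ 2)
    (hq : q * (L * δ) ^ 2 ≤ 1 / 2)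
    (hB : B.card * (8 * (q * (L * δ) ^ 2) ^ (2 * L) * L) ≤ 1 / 20)
    (hyes : ∑ a : Fin n → Fin (2 * L + 1), (∏ i, evenWeight L (a i)) *
      (if (Finset.univ.filter fun i => nodeMeans B (fun j => δ * centeredNode L j) a i ≠ 0).card ≤ k
        then 0 else 1) ≤ 1 / 12)
    {A : RandAlg n} (hA : A.MakesAtMost q) : ¬ IsJuntaTester {p | IsProduct p} k ε A := by
  have hnode : ∀ j, |δ * centeredNode L j| ≤ L * |δ| := fun j => by
    rw [abs_mul, mul_comm]
    exact mul_le_mul_of_nonneg_right (abs_centeredNode_le L j) (abs_nonneg δ)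
  have habs : (L * |δ|) ^ 2 = (L * δ) ^ 2 := by rw [mul_pow, sq_abs, ← mul_pow]
  have hsmall : L * |δ| < 1 := by
    refine lt_of_pow_lt_pow_left₀ 2 zero_le_one ?_
    rw [habs]
    nlinarith
  have hv1 : ∀ j, |δ * centeredNode L j| < 1 := fun j => (hnode j).trans_lt hsmall
  rw [← habs] at hq hB
  have hr := evenWeight_zeroIndex_ge hL
  have hL' : (0 : ℝ) < L := by exact_mod_cast hL
  refine ((matchedPriors_binomial hL).scale δ).not_isJuntaTester hv1 hnode hq B ?_ hyes ?_ hA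
  · refine le_trans ?_ hB
    refine mul_le_mul_of_nonneg_left ?_ (by positivity)
    rw [div_eq_mul_inv]
    refine mul_le_mul_of_nonneg_left ?_ (by positivity)
    rw [← one_div]
    exact (one_div_le (matchedPriors_binomial hL).pos hL').2 hr
  · intro a ha
    refine isFarFromJunta_meanPMF hε hε' _ _ (fun i => ?_) fun J hJ => ?_
    · unfold nodeMeans
      split_ifs
      · rw [← sq_abs]
        refine (pow_le_pow_left₀ (abs_nonneg _) (hnode _) 2).trans ?_
        rwa [habs]
      · nlinarith [sq_nonneg ε]
    · have hsub : B \ J ⊆ Jᶜ := fun i hi => by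
        rw [Finset.mem_compl]
        exact (Finset.mem_sdiff.1 hi).2
      have hc : (B.card : ℝ) - k ≤ ((B \ J).card : ℝ) := by
        have h1 := Finset.le_card_sdiff J B
        have h2 : B.card ≤ (B \ J).card + k := by omega
        have h3 : (B.card : ℝ) ≤ (B \ J).card + k := by exact_mod_cast h2
        linarith
      calc 1600 * ε ^ 2 ≤ (B.card - k : ℝ) * δ ^ 2 := hmin
        _ ≤ (B \ J).card * δ ^ 2 := mul_le_mul_of_nonneg_right hc (sq_nonneg _)
        _ = ∑ i ∈ B \ J, δ ^ 2 := by rw [Finset.sum_const, nsmul_eq_mul]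
        _ ≤ ∑ i ∈ B \ J, nodeMeans B (fun j => δ * centeredNode L j) a i ^ 2 := by
            refine Finset.sum_le_sum fun i hi => ?_
            rw [nodeMeans, if_pos (Finset.mem_sdiff.1 hi).1, mul_pow]
            exact le_mul_of_one_le_right (sq_nonneg _) (one_le_centeredNode_sq (ha i))
        _ ≤ _ := Finset.sum_le_sum_of_subset_of_nonneg hsub fun i _ _ => sq_nonneg _

/-! ### Choice of parameters. -/

/-- Uniformity testing: the lower bound of order `√n / ε ^ 2`. -/
theorem not_isJuntaTester_of_le_sqrt {k q : ℕ} {ε : ℝ} (hε : 0 < ε) (hε' : ε ≤ 1 / 200)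
    (hn : 2 ≤ n) (hk : 2 * k ≤ n) (hq : q * ε ^ 2 ≤ √n / 41600)
    {A : RandAlg n} (hA : A.MakesAtMost q) : ¬ IsJuntaTester {p | IsProduct p} k ε A := by
  have hk' : 2 * (k : ℝ) ≤ n := by exact_mod_cast hk
  have hn' : (2 : ℝ) ≤ n := by exact_mod_cast hn
  set s := √(n : ℝ) with hs
  have hs2 : s ^ 2 = n := Real.sq_sqrt (by linarith)
  have hs1 : 1 ≤ s := Real.one_le_sqrt.2 (by linarith)
  set D : ℝ := 1600 * ε ^ 2 / (n - k) with hD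
  have hnk : (0 : ℝ) < n - k := by linarith
  have hD0 : 0 ≤ D := by positivity
  have hDsq : √D ^ 2 = D := Real.sq_sqrt hD0
  have hDn : D ≤ 3200 * ε ^ 2 / n := by
    rw [hD, div_le_div_iff₀ hnk (by linarith)]
    nlinarith [pow_pos hε 2]
  have hβ : q * D ≤ 1 / (13 * s) := by
    calc q * D ≤ q * (3200 * ε ^ 2 / n) := mul_le_mul_of_nonneg_left hDn (by positivity)
      _ = 3200 * (q * ε ^ 2) / s ^ 2 := by rw [hs2]; ring
      _ ≤ 3200 * (s / 41600) / s ^ 2 := by gcongr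
      _ = 1 / (13 * s) := by field_simp; norm_num
  have hβ0 : 0 ≤ q * D := by positivity
  -- For `L = 1` the even prior is the point mass at zero and the odd one is uniform on `±1`: the
  -- uniform distribution against random means `±δ`.
  refine not_isJuntaTester_of_binomial (L := 1) le_rfl (δ := √D) hε hε' Finset.univ ?_ ?_ ?_ ?_ ?_ hA
  · rw [Nat.cast_one, one_mul, hDsq, hD]
    exact div_le_self (by positivity) (by linarith)
  · rw [hDsq, hD, Finset.card_univ, Fintype.card_fin, mul_div_cancel₀ _ hnk.ne']
  · rw [Nat.cast_one, one_mul, hDsq]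
    refine hβ.trans (one_div_le_one_div_of_le (by norm_num) (by linarith))
  · rw [Nat.cast_one, one_mul, hDsq, Finset.card_univ, Fintype.card_fin, mul_one, mul_one]
    have h1 : (q * D) ^ 2 ≤ (1 / (13 * s)) ^ 2 := pow_le_pow_left₀ hβ0 hβ 2
    calc (n : ℝ) * (8 * (q * D) ^ 2) ≤ n * (8 * (1 / (13 * s)) ^ 2) := by gcongr
      _ = 8 / 169 := by rw [← hs2]; field_simp; norm_num
      _ ≤ 1 / 20 := by norm_num
  · refine (Finset.sum_eq_zero fun a _ => ?_).le.trans (by norm_num)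
    by_cases ha : ∀ i, evenWeight 1 (a i) ≠ 0
    · have h0 : ∀ i, centeredNode 1 (a i) = 0 := by
        intro i
        have hi := ha i
        generalize a i = j at hi
        fin_cases j
        · exact absurd (if_neg (by decide)) hi
        · simp [centeredNode]
        · exact absurd (if_neg (by decide)) hi
      have hcard : (Finset.univ.filter fun i =>
          nodeMeans Finset.univ (fun j => √D * centeredNode 1 j) a i ≠ 0).card ≤ k := by
        rw [Finset.card_eq_zero.2 (Finset.filter_eq_empty_iff.2 fun i _ => by
          simp [nodeMeans, h0])]
        exact Nat.zero_le _
      rw [if_pos hcard, mul_zero]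
    · push Not at ha
      obtain ⟨i, hi⟩ := ha
      rw [Finset.prod_eq_zero (Finset.mem_univ i) hi, zero_mul]

theorem three_twenty_mul_le_two_pow {L : ℕ} (hL : 16 ≤ L) : 320 * L ≤ 2 ^ L := by
  induction L, hL using Nat.le_induction with
  | base => norm_num
  | succ L hL ih => rw [pow_succ]; omega

theorem eight_mul_cube_le_two_pow {L : ℕ} (hL : 16 ≤ L) : 8 * L ^ 3 ≤ 2 ^ L := by
  induction L, hL using Nat.le_induction with
  | base => norm_num
  | succ L hL ih =>
    rw [pow_succ 2]
    nlinarith [Nat.mul_le_mul hL (Nat.le_refl (L ^ 2)), Nat.mul_le_mul hL (Nat.le_refl L)]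

/-- The lower bound of order `k / ε ^ 2`, up to a power of the logarithm of `k`. -/
theorem not_isJuntaTester_of_le_div_log {k q L : ℕ} {ε : ℝ} (hε : 0 < ε) (hε' : ε ≤ 1 / 200)
    (hk : 2 * k ≤ n) (hL : 16 ≤ L) (hLk : 2 ^ L ≤ 2 * k) (hkL : k < 2 ^ L)
    (hq : q * ε ^ 2 ≤ k / (25600 * L ^ 3))
    {A : RandAlg n} (hA : A.MakesAtMost q) : ¬ IsJuntaTester {p | IsProduct p} k ε A := by
  have hcube : 4 * L ^ 3 ≤ k := by
    have := eight_mul_cube_le_two_pow hL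
    omega
  -- `m` is the surplus of `B` over the `k` allowed coordinates. It is small enough that the
  -- expected number of zeroed coordinates, at least `k / L`, is at least `4 * m`.
  set m := k / (4 * L) with hm
  have hLm : L ^ 2 ≤ m := by
    rw [hm, Nat.le_div_iff_mul_le (by omega)]
    linarith [show L ^ 2 * (4 * L) = 4 * L ^ 3 by ring]
  have hmk : m ≤ k := Nat.div_le_self _ _
  have hmk' : m * (4 * L) ≤ k := Nat.div_mul_le_self _ _
  have hm256 : 256 ≤ m := le_trans (by nlinarith) hLm
  have hkm : k ≤ 8 * L * m := by
    have h1 : k < 4 * L * (m + 1) := Nat.lt_mul_div_succ k (by omega)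
    nlinarith
  obtain ⟨B, -, hBcard⟩ := Finset.exists_subset_card_eq (s := (Finset.univ : Finset (Fin n)))
    (n := k + m) (by rw [Finset.card_univ, Fintype.card_fin]; omega)
  have hL0 : (0 : ℝ) < L := by
    have : 0 < L := by omega
    exact_mod_cast this
  have hm0 : (0 : ℝ) < m := by
    have : 0 < m := by omega
    exact_mod_cast this
  have hLmR : (L : ℝ) ^ 2 ≤ m := by exact_mod_cast hLm
  have hmkR : (m : ℝ) ≤ k := by exact_mod_cast hmk
  have hmkR' : (m : ℝ) * (4 * L) ≤ k := by exact_mod_cast hmk'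
  have hkmR : (k : ℝ) ≤ 8 * L * m := by exact_mod_cast hkm
  have hkLR : (k : ℝ) ≤ 2 ^ L := by exact_mod_cast hkL.le
  have hLR : 320 * (L : ℝ) ≤ 2 ^ L := by exact_mod_cast three_twenty_mul_le_two_pow hL
  have hBR : (B.card : ℝ) = k + m := by rw [hBcard]; push_cast; rfl
  set D : ℝ := 1600 * ε ^ 2 / m with hD
  have hD0 : 0 ≤ D := by positivity
  have hDsq : √D ^ 2 = D := Real.sq_sqrt hD0
  have hDL : (L * √D) ^ 2 = L ^ 2 * D := by rw [mul_pow, hDsq]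
  have hβ : q * (L ^ 2 * D) ≤ 1 / 2 := by
    calc (q : ℝ) * (L ^ 2 * D) = 1600 * (L : ℝ) ^ 2 / m * (q * ε ^ 2) := by rw [hD]; ring
      _ ≤ 1600 * (L : ℝ) ^ 2 / m * (8 * L * m / (25600 * L ^ 3)) := by
          refine mul_le_mul_of_nonneg_left (hq.trans ?_) (by positivity)
          gcongr
      _ = 1 / 2 := by field_simp; norm_num
  have hβ0 : 0 ≤ q * (L ^ 2 * D) := by positivity
  have hL1 : 1 ≤ L := by omega
  refine not_isJuntaTester_of_binomial hL1 (δ := √D) hε hε' B ?_ ?_ ?_ ?_ ?_ hA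
  · rw [hDL, hD, mul_div_left_comm]
    exact mul_le_of_le_one_right (by positivity) ((div_le_one hm0).2 hLmR)
  · rw [hDsq, hD, hBR, add_sub_cancel_left, mul_div_cancel₀ _ hm0.ne']
  · rwa [hDL]
  · rw [hDL, hBR]
    have h1 : (q * (L ^ 2 * D)) ^ (2 * L) ≤ (1 / 2) ^ (2 * L) := pow_le_pow_left₀ hβ0 hβ _
    have h2 : (1 / 2 : ℝ) ^ (2 * L) = 1 / (2 ^ L * 2 ^ L) := by
      rw [← pow_add, ← two_mul, one_div_pow]
    -- The factor `4 ^ (-L)` from the `2 * L` matched moments absorbs both `|B| ≤ 2 * 2 ^ L` and `L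
    -- ≤ 2 ^ L / 320`.
    calc ((k : ℝ) + m) * (8 * (q * (L ^ 2 * D)) ^ (2 * L) * L)
        ≤ (2 ^ L + 2 ^ L) * (8 * (1 / 2) ^ (2 * L) * (2 ^ L / 320)) := by
          gcongr
          · exact hmkR.trans hkLR
          · linarith
      _ = 1 / 20 := by rw [h2]; field_simp; norm_num
  · refine ((matchedPriors_binomial hL1).scale √D).sum_card_gt_le B (m := m) hBcard.le ?_ (by omega)
    rw [hBR]
    have h1 : 4 * (m : ℝ) ≤ k * (1 / L) := by
      rw [mul_one_div, le_div_iff₀ hL0]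
      linarith
    refine h1.trans (mul_le_mul ?_ (evenWeight_zeroIndex_ge hL1) (by positivity) (by positivity))
    linarith

end JuntaTesting
open JuntaTesting in
theorem theorem6 :
    ∃ (ε₀ : ℝ) (C₀ : ℕ) (c : ℝ) (d : ℕ), 0 < ε₀ ∧ 0 < c ∧
      ∀ (ε : ℝ) (n k : ℕ), 0 < ε → ε ≤ ε₀ → C₀ ≤ n → (k : ℝ) ≤ (n : ℝ) / 2 →
        ∀ (A : RandAlg n) (q : ℕ), A.MakesAtMost q →
          (IsJuntaTester Set.univ k ε A →
            c * (((k : ℝ) + √(n : ℝ)) / (1 + |Real.log ((k : ℝ) + √(n : ℝ))| ^ d)) / ε ^ 2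
              ≤ (q : ℝ)) ∧
          (IsJuntaTester {p | IsProduct p} k ε A →
            c * (((k : ℝ) + √(n : ℝ)) / (1 + |Real.log ((k : ℝ) + √(n : ℝ))| ^ d)) / ε ^ 2
              ≤ (q : ℝ)) := by
  -- `2 ^ 30` makes `√n ≥ 2 ^ 15`, so that `k > √n` yields `L ≥ 16`; the exponent 3 is that of `L ^
  -- 3`.
  refine ⟨1 / 200, 2 ^ 30, 1 / 2000000, 3, by norm_num, by norm_num, ?_⟩
  intro ε n k hε hε' hn hk A q hA
  suffices h : IsJuntaTester {p | IsProduct p} k ε A →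
      1 / 2000000 * (((k : ℝ) + √(n : ℝ)) / (1 + |Real.log ((k : ℝ) + √(n : ℝ))| ^ 3)) / ε ^ 2
        ≤ (q : ℝ) from ⟨fun hA' => h fun p _ => hA' p trivial, h⟩
  intro htest
  by_contra! hlt
  rw [lt_div_iff₀ (by positivity)] at hlt
  have hk2 : 2 * k ≤ n := by
    have : 2 * (k : ℝ) ≤ n := by linarith
    exact_mod_cast this
  have hnR : (2 : ℝ) ^ 30 ≤ n := by exact_mod_cast hn
  set s := √(n : ℝ) with hs
  have hs15 : (2 : ℝ) ^ 15 ≤ s := Real.le_sqrt_of_sq_le (by norm_num at hnR ⊢; exact hnR)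
  rcases le_or_gt (k : ℝ) s with hks | hks
  · refine not_isJuntaTester_of_le_sqrt hε hε' (by omega) hk2 ?_ hA htest
    have h1 : ((k : ℝ) + s) / (1 + |Real.log ((k : ℝ) + s)| ^ 3) ≤ k + s :=
      div_le_self (by positivity) (le_add_of_nonneg_right (by positivity))
    linarith
  · have hk15 : 2 ^ 15 ≤ k := by
      have : (2 : ℝ) ^ 15 ≤ k := by linarith
      exact_mod_cast this
    have hk0 : k ≠ 0 := by omega
    set l := Nat.log 2 k with hl
    have hl15 : 15 ≤ l := Nat.le_log_of_pow_le (by norm_num) hk15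
    have hlk : 2 ^ l ≤ k := Nat.pow_log_le_self 2 hk0
    refine not_isJuntaTester_of_le_div_log (L := l + 1) hε hε' hk2 (by omega)
      (by rw [pow_succ]; omega) (Nat.lt_pow_succ_log_self (by norm_num) k) ?_ hA htest
    have hkR : (0 : ℝ) < k := by positivity
    -- Since `log 2 > 0.69` and `l ≥ 15`, `l * log 2` exceeds `(l + 1) / 2`.
    have hlog : ((l + 1 : ℕ) : ℝ) / 2 ≤ Real.log ((k : ℝ) + s) := by
      have h1 : Real.log ((2 : ℝ) ^ l) ≤ Real.log ((k : ℝ) + s) := by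
        refine Real.log_le_log (by positivity) ?_
        have : (2 : ℝ) ^ l ≤ k := by exact_mod_cast hlk
        linarith
      rw [Real.log_pow] at h1
      have h2 := Real.log_two_gt_d9
      have h3 : (15 : ℝ) ≤ l := by exact_mod_cast hl15
      push_cast
      nlinarith
    have hcube : (((l + 1 : ℕ) : ℝ) / 2) ^ 3 ≤ |Real.log ((k : ℝ) + s)| ^ 3 :=
      pow_le_pow_left₀ (by positivity) (hlog.trans (le_abs_self _)) 3
    have hX : ((k : ℝ) + s) / (1 + |Real.log ((k : ℝ) + s)| ^ 3)
        ≤ (k + k) / (((l + 1 : ℕ) : ℝ) / 2) ^ 3 :=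
      div_le_div₀ (by positivity) (by linarith) (by positivity) (by linarith)
    have hY : ((k : ℝ) + k) / (((l + 1 : ℕ) : ℝ) / 2) ^ 3
        = 409600 * (k / (25600 * ((l + 1 : ℕ) : ℝ) ^ 3)) := by
      field_simp
      norm_num
    have hZ : 0 ≤ (k : ℝ) / (25600 * ((l + 1 : ℕ) : ℝ) ^ 3) := by positivity
    linarith
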